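/- For a field $K$ with algebraic closure $\overline K$ write $f\in K[x,y]$ as $f=\sum_{j=0}^n f_j(x)y^j$ with $f_j\in K[x]$, where $n=\deg_y f$. Call $f$ *reduced* if it is nonzero and no irreducible factor of $f$ in $K[x,y]$ appears multiple times, and *geometrically reduced* if $f$ is reduced in $\overline K[x,y]$. Let $\mathrm{Disc}_y(f)\in K[x]$ be the discriminant of $f$ as a polynomial in $y$, i.e. $f_n^{2n-2}\prod_{i<j}(b_i-b_j)^2$, where the $b_i$ are the roots of $f$, with multiplicity, in an algebraic closure of $K(x)$ (it is $1$ for $n=1$, and by convention also for $n=0$). If $f=\sum a_{ij}x^iy^j$ has degree $m$ in $x$ and $n$ in $y$, let $\hat f=\sum a_{ij}x^i\tilde x^{m-i}y^j\tilde y^{n-j}\in K[x,\tilde x,y,\tilde y]$ be its multi-homogenization and $\hat f_y$ the derivative of $\hat f$ with respect to $y$. Consider the following conditions on $f$: (A) $f$ is quasi-homogeneous with nonzero weight of $x$: there are integers $w,\alpha,\beta$ with $\alpha\neq0$ such that $w=\alpha i+\beta j$ whenever $a_{ij}\neq0$; (B) $f_0$, $f_n$ and $\mathrm{Disc}_y(f)$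 are nonzero monomials in $x$, i.e. of the form $cx^k$ with $c\in K^\times$, $k\ge 0$; (C) the subvarieties of $\mathbb P^1\times\mathbb P^1$ defined by $\hat f$ and $y\hat f_y$ have no common point in $\overline K^\times\times\mathbb P^1(\overline K)$, where $a\in\overline K^\times$ is identified with $[a:1]$. **Theorem.** (1) If $K$ is a field of characteristic $0$ and $f\in K[x,y]$ is reduced with $f_0\neq0$, then (A), (B) and (C) are equivalent. (2) For every $d\in\mathbb N$ there is $N_d\in\mathbb N$ such that for every field $K$ of characteristic $p>N_d$ and every geometrically reduced $f\in K[x,y]$ of total degree at most $d$ with $f_0\neq0$, (A), (B) and (C) are equivalent. -/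

import Mathlib

open Polynomial
open scoped Polynomial.Bivariate LinearAlgebra.Projectivization

/-! A bivariate polynomial `f(x, y) = ∑ f_j(x) y ^ j` is an element of `K[X][Y]`: the outer
variable is `y`, the inner one is `x`, `f.coeff j` is `f_j ∈ K[x]`, and `(f.coeff j).coeff i`
is the coefficient of `x ^ i * y ^ j`. Then `f.natDegree` is the degree in `y`, and
`Polynomial.discr f : K[X]` is the discriminant of `f` with respect to `y`. -/

namespace BivariateDisc

variable {K : Type*} [Field K]

/-- The degree of `f` in the variable `x`. -/
noncomputable def degreeX (f : K[X][Y]) : ℕ :=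
  f.support.sup fun j => (f.coeff j).natDegree

/-- The total degree of `f` in `x` and `y` is at most `d`. -/
def TotalDegreeLE (f : K[X][Y]) (d : ℕ) : Prop :=
  ∀ i j : ℕ, (f.coeff j).coeff i ≠ 0 → i + j ≤ d

/-- `f` is quasi-homogeneous of some type `(w; α, β)` whose weight `α` of `x` is non-zero. -/
def IsQuasiHomogeneousWithXWeight (f : K[X][Y]) : Prop :=
  ∃ w α β : ℤ, α ≠ 0 ∧
    ∀ i j : ℕ, (f.coeff j).coeff i ≠ 0 → w = α * (i : ℤ) + β * (j : ℤ)

/-- `p` is a non-zero monomial `c * x ^ k`. -/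
def IsNonzeroMonomial (p : K[X]) : Prop :=
  ∃ (k : ℕ) (c : K), c ≠ 0 ∧ p = monomial k c

/-- `f` is geometrically reduced: over an algebraic closure of the field of coefficients,
no irreducible factor of `f` appears multiple times. -/
def IsGeometricallyReduced (f : K[X][Y]) : Prop :=
  Squarefree (f.map (mapRingHom (algebraMap K (AlgebraicClosure K))))

/-- The multi-homogenization `∑ a_ij x ^ i * x' ^ (m - i) * y ^ j * y' ^ (n - j)` of
`f = ∑ a_ij x ^ i * y ^ j`, where `m` and `n` are the degrees of `f` in `x` and in `y`.
The variables `x, x', y, y'` have the indices `0, 1, 2, 3`. -/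
noncomputable def multiHomogenization (f : K[X][Y]) : MvPolynomial (Fin 4) K :=
  ∑ i ∈ Finset.range (degreeX f + 1), ∑ j ∈ Finset.range (f.natDegree + 1),
    MvPolynomial.C ((f.coeff j).coeff i) *
      MvPolynomial.X 0 ^ i * MvPolynomial.X 1 ^ (degreeX f - i) *
      MvPolynomial.X 2 ^ j * MvPolynomial.X 3 ^ (f.natDegree - j)

/-- The projective line over a field `L`. -/
abbrev ProjLine (L : Type*) [Field L] := ℙ L (Fin 2 → L)

/-- The set of `L`-points of `ℙ¹ × ℙ¹` at which the polynomial `g` in `x, x', y, y'` vanishes.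
(For a multi-homogeneous `g` it does not matter which homogeneous coordinates are used.) -/
def zeroLocus (L : Type*) [Field L] [Algebra K L] (g : MvPolynomial (Fin 4) K) :
    Set (ProjLine L × ProjLine L) :=
  {P | ∀ (a b : Fin 2 → L) (ha : a ≠ 0) (hb : b ≠ 0),
    Projectivization.mk L a ha = P.1 → Projectivization.mk L b hb = P.2 →
      MvPolynomial.aeval ![a 0, a 1, b 0, b 1] g = 0}

/-- The subset `Lˣ × ℙ¹` of `ℙ¹ × ℙ¹`, where `a ∈ Lˣ` is identified with `[a : 1]`. -/
def unitsTimesProjLine (L : Type*) [Field L] : Set (ProjLine L × ProjLine L) :=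
  {P | ∃ a : L, a ≠ 0 ∧ P.1 = Projectivization.mk L ![a, 1] (by simp)}

/-- The sub-varieties of `ℙ¹ × ℙ¹` defined by `f̂` and `y * f̂_y` have no common point within
`𝔾ₘ × ℙ¹`. As usual, points of varieties are geometric points, i.e. points over an
algebraic closure. -/
def NoCommonPoint (f : K[X][Y]) : Prop :=
  zeroLocus (AlgebraicClosure K) (multiHomogenization f) ∩
    zeroLocus (AlgebraicClosure K)
      (MvPolynomial.X 2 * MvPolynomial.pderiv 2 (multiHomogenization f)) ∩
    unitsTimesProjLine (AlgebraicClosure K) = ∅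

end BivariateDisc

/-! Three conditions on `f` are in play: (A) quasi-homogeneity, (B) `f_0`, `f_n` and the
discriminant are nonzero monomials, (C) `NoCommonPoint`. Over an algebraically closed `L`, (B) and
(C) both say that `f_0`, `f_n` and the discriminant have no zero on `Lˣ`: a common point of `f̂`
and `y * f̂_y` over `x = a` sits at `y = 0` if `f_0(a) = 0`, at `y = ∞` if `f_n(a) = 0`, and
otherwise at a multiple root of `f(a, y)` (`noCommonPoint_iff`). For (A) ⇒ (B), the discriminant is
nonzero as `f` is squarefree and `deg_y f` is small compared to a positive characteristic
(`discr_ne_zero_of_squarefree`), and the scaling action of `Lˣ` shows that a zero `a ≠ 0` of it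
would spread to all of `Lˣ` (`isNonzeroMonomial_discr_of_isQuasiHomogeneous`).

The remaining implication (B) ⇒ (A) says that a cover of the punctured line `Lˣ`, étale and given
by invertible functions `y = b_i`, is a Kummer cover. Let `D = x d/dx`. The roots `b_i` of `f`, and
their differences, are units in the integral closure of `A = L[x, x⁻¹]`, so `D b_i / b_i` and
`D (b_i - b_j) / (b_i - b_j)` are integral over `A`. By Puiseux's theorem (`exists_splits_ramify`,
which needs that the positive integers up to `deg_y f` are invertible in `L`) all roots are Laurent
series in a root of `x`, or of `x⁻¹`, and logarithmic derivatives of such series for `D` are power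
series. Thus the logarithmic derivatives above have no pole at `0` and `∞` either, so they are
constants (`exists_eq_algebraMap_C`). Comparing the constants for `b_i`, `b_j` and `b_i - b_j`
shows that `D b_i = c * b_i` with the same `c` for all roots (`exists_eulerDeriv_root_eq`). For the
elementary symmetric functions this means that `i = k + (n - j) * c` in `L` for all monomials
`x ^ i * y ^ j` of `f`, where `x ^ k` is the monomial in `f_n`. Eliminating `c` with the exponent of
`f_0` gives a relation between integers in `L`, hence a relation in `ℤ` if the characteristic is
zero or large compared to the total degree (`isQuasiHomogeneous_of_isNonzeroMonomial`). -/

namespace BivariateDisc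

/-! ### Factoring over complete local rings, and ramified substitutions -/

/-- Over a complete local ring, a polynomial whose reduction vanishes at zero but has a nonzero
coefficient below the degree of the polynomial has a monic proper factor: the distinguished
polynomial of the Weierstrass preparation theorem. -/
theorem exists_factor_of_isAdicComplete {A : Type*} [CommRing A] [IsLocalRing A]
    [IsAdicComplete (IsLocalRing.maximalIdeal A) A] {h : A[X]}
    (h0 : h.coeff 0 ∈ IsLocalRing.maximalIdeal A)
    {j : ℕ} (hj : j < h.natDegree) (hjc : h.coeff j ∉ IsLocalRing.maximalIdeal A) :
    ∃ P : A[X], P.Monic ∧ P ∣ h ∧ 0 < P.natDegree ∧ P.natDegree < h.natDegree := by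
  have hres : ∀ i, PowerSeries.coeff i ((h : PowerSeries A).map (IsLocalRing.residue A)) =
      IsLocalRing.residue A (h.coeff i) := by
    intro i; simp
  have hjne : PowerSeries.coeff j ((h : PowerSeries A).map (IsLocalRing.residue A)) ≠ 0 := by
    rw [hres, Ne, IsLocalRing.residue_eq_zero_iff]
    exact hjc
  have hne : (h : PowerSeries A).map (IsLocalRing.residue A) ≠ 0 := by
    intro hz
    simp [hz] at hjne
  obtain ⟨P, u, H⟩ := PowerSeries.exists_isWeierstrassFactorization hne
  have hdeg := H.natDegree_eq_toNat_order_map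
  have hordtop : ((h : PowerSeries A).map (IsLocalRing.residue A)).order ≠ ⊤ := by
    simpa [PowerSeries.order_eq_top] using hne
  refine ⟨P, H.isDistinguishedAt.monic, ?_, ?_, ?_⟩
  · rw [← Ideal.mem_span_singleton, ← Ideal.Quotient.eq_zero_iff_mem]
    apply H.isDistinguishedAt.algEquivQuotient.injective
    -- the distinguished polynomial divides `h` already as a polynomial, as `A[X] / P = A⟦X⟧ / P`
    rw [map_zero, IsDistinguishedAt.algEquivQuotient_apply]
    change Ideal.Quotient.mk _ (h : PowerSeries A) = 0
    rw [Ideal.Quotient.eq_zero_iff_mem, Ideal.mem_span_singleton]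
    exact ⟨u, H.eq_mul⟩
  · rw [hdeg, Nat.pos_iff_ne_zero]
    intro hz
    rw [ENat.toNat_eq_zero] at hz
    rcases hz with hz | hz
    · refine absurd (IsLocalRing.residue_eq_zero_iff _ |>.2 h0) ?_
      rw [← hres]
      have := PowerSeries.coeff_order (φ := (h : PowerSeries A).map (IsLocalRing.residue A)) hne
      simpa [hz] using this
    · exact hordtop hz
  · rw [hdeg]
    have := PowerSeries.order_le j hjne
    have h2 := ENat.toNat_le_of_le_natCast this
    omega

section Ramification

variable {L : Type*} [Field L]

/-- The substitution `s ↦ s ^ N` on Laurent series in `s`. -/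
noncomputable def ramify (L : Type*) [Field L] (N : ℕ) [NeZero N] :
    LaurentSeries L →+* LaurentSeries L :=
  HahnSeries.embDomainRingHom (AddMonoidHom.mulLeft (N : ℤ))
    (fun _ _ h => mul_left_cancel₀ (Nat.cast_ne_zero.2 (NeZero.ne N)) h)
    (fun _ _ => mul_le_mul_iff_right₀ (Nat.cast_pos.2 (NeZero.pos N)))

theorem ramify_coeff_mul (N : ℕ) [NeZero N] (a : LaurentSeries L) (i : ℤ) :
    (ramify L N a).coeff (N * i) = a.coeff i :=
  HahnSeries.embDomain_coeff (f := ⟨⟨AddMonoidHom.mulLeft (N : ℤ), _⟩, _⟩)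

theorem ramify_coeff_of_not_dvd (N : ℕ) [NeZero N] (a : LaurentSeries L) {k : ℤ}
    (hk : ¬ (N : ℤ) ∣ k) : (ramify L N a).coeff k = 0 := by
  refine HahnSeries.embDomain_of_notMem_range ?_
  rintro ⟨i, hi⟩
  exact hk ⟨i, hi.symm⟩

theorem ramify_single (N : ℕ) [NeZero N] (i : ℤ) (r : L) :
    ramify L N (HahnSeries.single i r) = HahnSeries.single (N * i) r :=
  HahnSeries.embDomain_single

theorem ramify_ramify (N M : ℕ) [NeZero N] [NeZero M] (a : LaurentSeries L) :
    ramify L N (ramify L M a) = ramify L (N * M) a := by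
  ext k
  by_cases h1 : (N : ℤ) ∣ k
  · obtain ⟨j, rfl⟩ := h1
    rw [ramify_coeff_mul]
    by_cases h2 : (M : ℤ) ∣ j
    · obtain ⟨i, rfl⟩ := h2
      have := ramify_coeff_mul (N * M) a i
      rw [ramify_coeff_mul, ← this]
      push_cast
      rw [mul_assoc]
    · rw [ramify_coeff_of_not_dvd _ _ h2, ramify_coeff_of_not_dvd]
      intro h3
      push_cast at h3
      exact h2 ((mul_dvd_mul_iff_left (by exact_mod_cast NeZero.ne N)).1 h3)
  · rw [ramify_coeff_of_not_dvd _ _ h1, ramify_coeff_of_not_dvd]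
    intro h3
    push_cast at h3
    exact h1 (dvd_of_mul_right_dvd h3)

end Ramification

/-- The power series within the Laurent series, as a subring: no negative exponents. -/
noncomputable def integralSeries (L : Type*) [Field L] : Subring (LaurentSeries L) :=
  (HahnSeries.ofPowerSeries ℤ L).range

theorem mem_integralSeries {L : Type*} [Field L] {a : LaurentSeries L} :
    a ∈ integralSeries L ↔ ∀ k < 0, a.coeff k = 0 := by
  constructor
  · rintro ⟨p, rfl⟩ k hk
    exact HahnSeries.embDomain_of_notMem_range (by rintro ⟨n, rfl⟩; simp at hk; omega)
  · intro h
    refine ⟨PowerSeries.mk fun n => a.coeff n, ?_⟩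
    ext k
    rcases lt_or_ge k 0 with hk | hk
    · rw [h k hk]
      exact HahnSeries.embDomain_of_notMem_range (by rintro ⟨n, rfl⟩; simp at hk; omega)
    · lift k to ℕ using hk
      rw [LaurentSeries.coeff_coe_powerSeries, PowerSeries.coeff_mk]

/-! ### Puiseux's theorem -/

/-- A translation by `r` adds `n * r` to the second highest coefficient of a monic polynomial of
degree `n`. -/
theorem taylor_coeff_natDegree_pred {R : Type*} [CommRing R] {f : R[X]} (hm : f.Monic)
    {m : ℕ} (hd : f.natDegree = m + 1) (r : R) :
    (taylor r f).coeff m = f.coeff m + (m + 1 : ℕ) * r := by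
  have h : hasseDeriv m f = C (f.coeff m) + C ((m + 1 : ℕ) : R) * X := by
    ext k
    rw [hasseDeriv_coeff]
    rcases k with _ | _ | k
    · simp
    · have : f.coeff (0 + 1 + m) = 1 := by
        rw [zero_add, add_comm, ← hd]; exact hm
      rw [this]
      simp [Nat.add_comm 1 m]
    · have : f.coeff (k + 1 + 1 + m) = 0 := coeff_eq_zero_of_natDegree_lt (by omega)
      rw [this]
      simp [coeff_one]
  rw [taylor_coeff, h]
  simp

section

variable {L : Type*} [Field L] [IsAlgClosed L]

/-- If the second highest coefficient vanishes and some lower coefficient is a unit, the reduction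
of `h` is not a power of a linear polynomial, so the translate of `h` by a root of the reduction
has a proper factor. -/
theorem exists_factor_taylor {m : ℕ} {h : (PowerSeries L)[X]} (hm : h.Monic)
    (hd : h.natDegree = m + 1) (hmL : ((m + 1 : ℕ) : L) ≠ 0) (h0 : h.coeff m = 0)
    {j : ℕ} (hj : j < m + 1) (hjc : PowerSeries.constantCoeff (h.coeff j) ≠ 0) :
    ∃ (P : (PowerSeries L)[X]) (c : PowerSeries L), P.Monic ∧ P ∣ taylor c h ∧
      0 < P.natDegree ∧ P.natDegree < m + 1 := by
  have hmem : ∀ a : PowerSeries L, a ∈ IsLocalRing.maximalIdeal (PowerSeries L) ↔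
      PowerSeries.constantCoeff a = 0 := by
    intro a
    rw [PowerSeries.maximalIdeal_eq_span_X, Ideal.mem_span_singleton, PowerSeries.X_dvd_iff]
  have : IsAdicComplete (IsLocalRing.maximalIdeal (PowerSeries L)) (PowerSeries L) := by
    rw [PowerSeries.maximalIdeal_eq_span_X]; infer_instance
  set κ : PowerSeries L →+* L := PowerSeries.constantCoeff
  have hmon : (h.map κ).Monic := hm.map κ
  have hdeg : (h.map κ).natDegree = m + 1 := by rw [hm.natDegree_map, hd]
  obtain ⟨c, hc⟩ := IsAlgClosed.exists_root (h.map κ) (by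
    rw [degree_eq_natDegree hmon.ne_zero, hdeg]; exact_mod_cast Nat.succ_ne_zero m)
  have hκc : κ (PowerSeries.C c) = c := by simp [κ]
  have htay : (taylor (PowerSeries.C c) h).map κ = taylor c (h.map κ) := by
    rw [map_taylor, hκc]
  have hgd : (taylor (PowerSeries.C c) h).natDegree = m + 1 := by rw [natDegree_taylor, hd]
  have hgm : (taylor (PowerSeries.C c) h).Monic := by
    rw [Monic, leadingCoeff_taylor]; exact hm
  have key : ∃ i < m + 1, κ ((taylor (PowerSeries.C c) h).coeff i) ≠ 0 := by
    by_contra! hall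
    have h1 : (taylor c (h.map κ)).coeff m = 0 := by
      rw [← htay, coeff_map]; exact hall m (by omega)
    rw [taylor_coeff_natDegree_pred hmon hdeg, coeff_map, h0, map_zero, zero_add] at h1
    -- the reduction would be `(X - c) ^ (m + 1)`, with `c = 0` as its next coefficient is zero
    have hc0 : c = 0 := (mul_eq_zero.1 h1).resolve_left hmL
    refine hjc ?_
    have := hall j hj
    rwa [hc0, map_zero, taylor_zero] at this
  obtain ⟨i, hi, hic⟩ := key
  obtain ⟨P, hP, hdvd, hlt, hlt'⟩ := exists_factor_of_isAdicComplete (by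
    rw [hmem]
    rw [← coeff_map, htay, taylor_coeff_zero]
    exact hc) (hgd.symm ▸ hi) (by rw [hmem]; exact hic)
  exact ⟨P, _, hP, hdvd, hlt, hgd ▸ hlt'⟩

end

section

variable {L : Type*} [Field L]

theorem ramify_coeff_of_lt_order (N : ℕ) [NeZero N] (a : LaurentSeries L)
    {k : ℤ} (hk : k < N * a.order) : (ramify L N a).coeff k = 0 := by
  by_cases h : (N : ℤ) ∣ k
  · obtain ⟨i, rfl⟩ := h
    rw [ramify_coeff_mul]
    exact HahnSeries.coeff_eq_zero_of_lt_order
      (lt_of_mul_lt_mul_left hk (by positivity))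
  · exact ramify_coeff_of_not_dvd _ _ h

/-- The Newton polygon step: after the substitution `s ↦ s ^ q` and a scaling of the variable by
a power of `s`, the coefficients are power series, and one that is not leading is a unit. -/
theorem exists_newton_scaling {m : ℕ} {h : (LaurentSeries L)[X]} (hm : h.Monic)
    (hd : h.natDegree = m + 1) (h0 : h.coeff m = 0) (hne : h ≠ X ^ (m + 1)) :
    ∃ (q : ℕ) (_ : NeZero q) (p : ℤ) (g : (PowerSeries L)[X]), q ≤ m + 1 ∧ g.Monic ∧
      g.natDegree = m + 1 ∧ g.coeff m = 0 ∧
      (∃ j < m + 1, PowerSeries.constantCoeff (g.coeff j) ≠ 0) ∧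
      g.map (HahnSeries.ofPowerSeries ℤ L) = C (HahnSeries.single (-(p * (m + 1))) 1) *
        (h.map (ramify L q)).comp (C (HahnSeries.single p 1) * X) := by
  classical
  have hsupp : ((Finset.range (m + 1)).filter fun j => h.coeff j ≠ 0).Nonempty := by
    by_contra hcon
    rw [Finset.not_nonempty_iff_eq_empty, Finset.filter_eq_empty_iff] at hcon
    refine hne ?_
    ext1 k
    rw [coeff_X_pow]
    split_ifs with hk
    · rw [hk, ← hd]; exact hm
    · rcases lt_or_gt_of_ne hk with hk | hk
      · simpa using hcon (Finset.mem_range.2 hk)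
      · exact coeff_eq_zero_of_natDegree_lt (by omega)
  -- `p / q` is the smallest slope, attained at the index `i`
  obtain ⟨i, hi, hmin⟩ := Finset.exists_min_image _
    (fun j => ((h.coeff j).order : ℚ) / ((m + 1 - j : ℕ) : ℚ)) hsupp
  rw [Finset.mem_filter, Finset.mem_range] at hi
  obtain ⟨hi, hic⟩ := hi
  have hq : NeZero (m + 1 - i) := ⟨by omega⟩
  set q := m + 1 - i with hqdef
  set p := (h.coeff i).order with hpdef
  have hle : ∀ j < m + 1, h.coeff j ≠ 0 → p * (m + 1 - j) ≤ q * (h.coeff j).order := by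
    intro j hj hjc
    have := hmin j (by simp [hj, hjc])
    rw [div_le_div_iff₀ (by exact_mod_cast NeZero.pos q)
      (by rw [Nat.cast_pos]; omega)] at this
    have h2 : p * ((m + 1 - j : ℕ) : ℤ) ≤ (h.coeff j).order * (q : ℤ) := by
      exact_mod_cast this
    rw [Nat.cast_sub hj.le] at h2
    push_cast at h2
    linarith
  set G : (LaurentSeries L)[X] := C (HahnSeries.single (-(p * (m + 1))) 1) *
        (h.map (ramify L q)).comp (C (HahnSeries.single p 1) * X) with hG
  have hsp : ∀ j : ℕ, (HahnSeries.single p (1 : L)) ^ j = HahnSeries.single (p * j) 1 := by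
    intro j; rw [HahnSeries.single_pow, one_pow, nsmul_eq_mul, mul_comm]
  have hGc : ∀ j, G.coeff j = HahnSeries.single (p * j - p * (m + 1)) 1 *
      ramify L q (h.coeff j) := by
    intro j
    rw [hG, coeff_C_mul, comp_C_mul_X_coeff, coeff_map, hsp, mul_comm (ramify L q _), ← mul_assoc,
      HahnSeries.single_mul_single, one_mul]
    congr 3; ring
  have hGtop : G.coeff (m + 1) = 1 := by
    rw [hGc, ← hd, show h.coeff h.natDegree = 1 from hm, hd]
    simp
  have hGbig : ∀ j, m + 1 < j → G.coeff j = 0 := by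
    intro j hj
    rw [hGc, coeff_eq_zero_of_natDegree_lt (by omega)]
    simp
  have hGd : G.natDegree = m + 1 := by
    refine natDegree_eq_of_le_of_coeff_ne_zero ?_ (by rw [hGtop]; exact one_ne_zero)
    rw [natDegree_le_iff_coeff_eq_zero]
    exact fun j hj => hGbig j hj
  have hGm : G.Monic := by rw [Monic, leadingCoeff, hGd, hGtop]
  have hlift : G ∈ lifts (HahnSeries.ofPowerSeries ℤ L) := by
    rw [lifts_iff_coeff_lifts]
    intro j
    change G.coeff j ∈ integralSeries L
    rcases lt_trichotomy j (m + 1) with hj | hj | hj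
    · by_cases hjc : h.coeff j = 0
      · rw [hGc, hjc, map_zero, mul_zero]; exact zero_mem _
      · rw [mem_integralSeries]
        intro k hk
        rw [hGc, HahnSeries.coeff_single_mul, one_mul]
        refine ramify_coeff_of_lt_order q _ ?_
        have := hle j hj hjc
        linarith
    · rw [hj, hGtop]; exact one_mem _
    · rw [hGbig j hj]; exact zero_mem _
  obtain ⟨g, hg, hgd, hgm⟩ := lifts_and_natDegree_eq_and_monic hlift hGm
  have hinj : Function.Injective (HahnSeries.ofPowerSeries ℤ L) :=
    HahnSeries.ofPowerSeries_injective
  refine ⟨q, hq, p, g, by omega, hgm, hgd.trans hGd, ?_, ⟨i, hi, ?_⟩, hg⟩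
  · apply hinj
    rw [← coeff_map, hg, hGc, h0]
    simp
  · have h1 : HahnSeries.ofPowerSeries ℤ L (g.coeff i) = G.coeff i := by rw [← coeff_map, hg]
    have h2 := LaurentSeries.coeff_coe_powerSeries (g.coeff i) 0
    rw [PowerSeries.coeff_zero_eq_constantCoeff_apply] at h2
    rw [← h2, h1, hGc, HahnSeries.coeff_single_mul, one_mul]
    have : ((0 : ℕ) : ℤ) - (p * i - p * (m + 1)) = q * p := by
      rw [hqdef, Nat.cast_sub hi.le]; push_cast; ring
    rw [this, ramify_coeff_mul]
    exact fun h => hic (HahnSeries.coeff_order_eq_zero.1 h)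

end

section

variable {L : Type*} [Field L] [IsAlgClosed L]

theorem eval₂_taylor {R S : Type*} [CommRing R] [CommRing S] (f : R →+* S) (c : R) (x : S)
    (h : R[X]) : (taylor c h).eval₂ f x = h.eval₂ f (x + f c) := by
  rw [taylor_apply, eval₂_comp]
  simp

/-- A Laurent series polynomial of positive degree has a root after a substitution `s ↦ s ^ N`. -/
theorem exists_root_ramify (m : ℕ) (hmL : ∀ k : ℕ, 0 < k → k ≤ m + 1 → (k : L) ≠ 0)
    (h : (LaurentSeries L)[X]) (hm : h.Monic) (hd : h.natDegree = m + 1) :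
    ∃ (N : ℕ) (_ : NeZero N), (N : L) ≠ 0 ∧ ∃ β, h.eval₂ (ramify L N) β = 0 := by
  induction m using Nat.strong_induction_on generalizing h with
  | _ m ih =>
  have hmM : ((m + 1 : ℕ) : LaurentSeries L) ≠ 0 := by
    have := hmL (m + 1) (by omega) le_rfl
    rw [← map_natCast (HahnSeries.C : L →+* LaurentSeries L)]
    exact fun h => this (HahnSeries.C_injective (h.trans (map_zero _).symm))
  set t : LaurentSeries L := - (h.coeff m) / (m + 1 : ℕ) with ht
  -- the Tschirnhaus transform removes the second highest coefficient
  set h1 := taylor t h with hh1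
  have hd1 : h1.natDegree = m + 1 := by rw [hh1, natDegree_taylor, hd]
  have hm1 : h1.Monic := by
    rw [Monic, leadingCoeff_taylor]; exact hm
  have h10 : h1.coeff m = 0 := by
    rw [hh1, taylor_coeff_natDegree_pred hm hd, ht, mul_div_cancel₀ _ hmM, add_neg_cancel]
  suffices H : ∃ (N : ℕ) (_ : NeZero N), (N : L) ≠ 0 ∧ ∃ β, h1.eval₂ (ramify L N) β = 0 by
    obtain ⟨N, hN, hNL, β, hβ⟩ := H
    exact ⟨N, hN, hNL, _, by rwa [hh1, eval₂_taylor] at hβ⟩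
  by_cases hX : h1 = X ^ (m + 1)
  · exact ⟨1, inferInstance, by simp, 0, by simp [hX]⟩
  obtain ⟨q, hq, p, g, hqm, hgm, hgd, hg0, ⟨j, hj, hjc⟩, hg⟩ :=
    exists_newton_scaling hm1 hd1 h10 hX
  obtain ⟨P, c, hP, hdvd, hlt, hlt'⟩ := exists_factor_taylor hgm hgd
    (hmL _ (by omega) le_rfl) hg0 hj hjc
  obtain ⟨N, hN, hNL, β, hβ⟩ := ih (P.natDegree - 1) (by omega)
    (fun k hk hk' => hmL k hk (by omega)) (P.map (HahnSeries.ofPowerSeries ℤ L)) (hP.map _)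
    (by rw [hP.natDegree_map]; omega)
  refine ⟨N * q, inferInstance, ?_, ramify L N (HahnSeries.single p 1) *
    (β + ramify L N (HahnSeries.ofPowerSeries ℤ L c)), ?_⟩
  · push_cast
    exact mul_ne_zero hNL (hmL q (NeZero.pos q) hqm)
  · obtain ⟨Q, hQ⟩ := hdvd
    have h2 : (taylor c g).eval₂ ((ramify L N).comp (HahnSeries.ofPowerSeries ℤ L)) β = 0 := by
      rw [hQ, eval₂_mul, ← eval₂_map, hβ, zero_mul]
    rw [eval₂_taylor, ← eval₂_map, hg, eval₂_mul, eval₂_C, mul_eq_zero] at h2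
    rcases h2 with h2 | h2
    · simp at h2
    · rw [eval₂_comp, eval₂_map] at h2
      have hcomp : (ramify L N).comp (ramify L q) = ramify L (N * q) :=
        RingHom.ext fun a => ramify_ramify N q a
      rw [hcomp] at h2
      simpa using h2

/-- **Puiseux's theorem**: a polynomial over the Laurent series field splits after a substitution
`s ↦ s ^ N`, if all positive integers up to its degree are invertible. -/
theorem exists_splits_ramify (n : ℕ) (hnL : ∀ k : ℕ, 0 < k → k ≤ n → (k : L) ≠ 0)
    (h : (LaurentSeries L)[X]) (hd : h.natDegree ≤ n) :
    ∃ (N : ℕ) (_ : NeZero N), (N : L) ≠ 0 ∧ (h.map (ramify L N)).Splits := by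
  induction n generalizing h with
  | zero => exact ⟨1, inferInstance, by simp, Splits.of_natDegree_le_one
      ((natDegree_map_le).trans (by omega))⟩
  | succ n ih =>
  rcases Nat.lt_or_ge h.natDegree (n + 1) with hlt | hge
  · exact ih (fun k hk hk' => hnL k hk (by omega)) h (by omega)
  have hd' : h.natDegree = n + 1 := by omega
  have hne : h ≠ 0 := by rintro rfl; simp at hd'
  have hlc : h.leadingCoeff ≠ 0 := leadingCoeff_ne_zero.2 hne
  obtain ⟨N, hN, hNL, β, hβ⟩ := exists_root_ramify n hnL (h * C h.leadingCoeff⁻¹)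
    (monic_mul_leadingCoeff_inv hne) (by rw [natDegree_mul_C (inv_ne_zero hlc), hd'])
  rw [eval₂_mul, eval₂_C, mul_eq_zero, or_iff_left (by simpa using hlc), ← eval_map] at hβ
  obtain ⟨Q, hQ⟩ := dvd_iff_isRoot.2 hβ
  have hQd : Q.natDegree ≤ n := by
    have h1 : (h.map (ramify L N)).natDegree = n + 1 := by rw [natDegree_map, hd']
    have hQ0 : Q ≠ 0 := by rintro rfl; rw [hQ] at h1; simp at h1
    rw [hQ, natDegree_mul (X_sub_C_ne_zero β) hQ0, natDegree_X_sub_C] at h1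
    omega
  obtain ⟨N', hN', hNL', hs⟩ := ih (fun k hk hk' => hnL k hk (by omega)) Q hQd
  refine ⟨N' * N, inferInstance, by push_cast; exact mul_ne_zero hNL' hNL, ?_⟩
  have hcomp : (ramify L N').comp (ramify L N) = ramify L (N' * N) :=
    RingHom.ext fun a => ramify_ramify N' N a
  rw [← hcomp, ← Polynomial.map_map, hQ, Polynomial.map_mul]
  refine Splits.mul ?_ hs
  exact (Splits.X_sub_C β).map _

end

/-! ### The Euler derivation, and constants as functions without poles -/

section

variable {L : Type*} [Field L]

/-- The Euler derivation `s d/ds` on Laurent series in `s`. -/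
noncomputable def eulerDeriv (L : Type*) [Field L] : LaurentSeries L →+ LaurentSeries L where
  toFun a :=
    { coeff := fun n => (n : L) * a.coeff n
      isPWO_support' := a.isPWO_support.mono fun n hn h => hn (by simp [h]) }
  map_zero' := by ext; simp
  map_add' a b := by ext; simp [mul_add]

@[simp]
theorem eulerDeriv_coeff (a : LaurentSeries L) (n : ℤ) :
    (eulerDeriv L a).coeff n = n * a.coeff n := rfl

theorem support_eulerDeriv_subset (a : LaurentSeries L) :
    (eulerDeriv L a).support ⊆ a.support := fun n hn h => hn (by simp [h])

theorem eulerDeriv_mul (a b : LaurentSeries L) :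
    eulerDeriv L (a * b) = eulerDeriv L a * b + a * eulerDeriv L b := by
  ext n
  rw [HahnSeries.coeff_add, eulerDeriv_coeff, HahnSeries.coeff_mul,
    HahnSeries.coeff_mul_left' a.isPWO_support (support_eulerDeriv_subset a),
    HahnSeries.coeff_mul_right' b.isPWO_support (support_eulerDeriv_subset b),
    ← Finset.sum_add_distrib, Finset.mul_sum]
  refine Finset.sum_congr rfl fun ij hij => ?_
  rw [Finset.mem_antidiagonal] at hij
  rw [eulerDeriv_coeff, eulerDeriv_coeff, ← hij.2.2]
  push_cast
  ring

theorem eulerDeriv_C (c : L) : eulerDeriv L (HahnSeries.C c) = 0 := by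
  ext n
  rw [eulerDeriv_coeff, HahnSeries.C_apply, HahnSeries.coeff_single]
  split_ifs with h <;> simp [h]

theorem eulerDeriv_C_mul (c : L) (a : LaurentSeries L) :
    eulerDeriv L (HahnSeries.C c * a) = HahnSeries.C c * eulerDeriv L a := by
  rw [eulerDeriv_mul, eulerDeriv_C, zero_mul, zero_add]

theorem eulerDeriv_one : eulerDeriv L (1 : LaurentSeries L) = 0 := by
  simpa using eulerDeriv_C (1 : L)

/-- The logarithmic derivative for `s d/ds` has no pole, as `s d/ds` does not lower the order. -/
theorem eulerDeriv_div_mem (a : LaurentSeries L) : eulerDeriv L a / a ∈ integralSeries L := by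
  rw [mem_integralSeries]
  by_cases hd : eulerDeriv L a = 0
  · simp [hd]
  have ha : a ≠ 0 := by rintro rfl; exact hd (map_zero _)
  intro k hk
  have h1 : a * (eulerDeriv L a / a) = eulerDeriv L a := mul_div_cancel₀ _ ha
  have h2 := HahnSeries.order_mul ha (div_ne_zero hd ha)
  rw [h1] at h2
  have h3 : a.order ≤ (eulerDeriv L a).order :=
    HahnSeries.order_le_of_coeff_ne_zero fun h =>
      (fun h => hd (HahnSeries.coeff_order_eq_zero.1 h)) (by rw [eulerDeriv_coeff, h, mul_zero])
  exact HahnSeries.coeff_eq_zero_of_lt_order (by omega)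

/-- The homomorphism from Laurent polynomials in `T` to Laurent series in `s` with
`T ↦ s ^ k`. -/
noncomputable def toSeries (L : Type*) [Field L] (k : ℤ) :
    LaurentPolynomial L →+* LaurentSeries L :=
  LaurentPolynomial.eval₂ HahnSeries.C (Units.mk0 (HahnSeries.single k (1 : L)) (by simp))

theorem toSeries_C_mul_T (k : ℤ) (r : L) (n : ℤ) :
    toSeries L k (LaurentPolynomial.C r * LaurentPolynomial.T n) = HahnSeries.single (k * n) r := by
  have h : (HahnSeries.single k (1 : L)) ^ n = HahnSeries.single (k * n) 1 := by
    cases n with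
    | ofNat n => simp [HahnSeries.single_pow, mul_comm]
    | negSucc n =>
      rw [zpow_negSucc, HahnSeries.single_pow, HahnSeries.inv_single]
      congr 1
      · rw [Int.negSucc_eq, nsmul_eq_mul, Nat.cast_succ, mul_neg, mul_comm]
      · simp
  rw [toSeries, LaurentPolynomial.eval₂_C_mul_T, Units.val_zpow_eq_zpow_val, Units.val_mk0, h,
    HahnSeries.C_apply, HahnSeries.single_mul_single, zero_add, mul_one]

theorem toSeries_coeff (k : ℤ) (hk : k ≠ 0) (a : LaurentPolynomial L) (i : ℤ) :
    (toSeries L k a).coeff (k * i) = a.coeff i := by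
  induction a using LaurentPolynomial.induction_on' with
  | add p q hp hq => simp [hp, hq]
  | C_mul_T n r =>
    rw [toSeries_C_mul_T, HahnSeries.coeff_single, ← LaurentPolynomial.single_eq_C_mul_T,
      AddMonoidAlgebra.coeff_single, Finsupp.single_apply]
    simp [hk, eq_comm]

theorem toSeries_injective {k : ℤ} (hk : k ≠ 0) : Function.Injective (toSeries L k) := by
  intro a b h
  ext i
  rw [← toSeries_coeff k hk, h, toSeries_coeff k hk]

theorem ramify_comp_toSeries (N : ℕ) [NeZero N] (k : ℤ) :
    (ramify L N).comp (toSeries L k) = toSeries L (N * k) := by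
  refine RingHom.ext fun a => ?_
  induction a using LaurentPolynomial.induction_on' with
  | add p q hp hq => rw [map_add, hp, hq, map_add]
  | C_mul_T n r =>
    rw [RingHom.comp_apply, toSeries_C_mul_T, toSeries_C_mul_T, ramify_single, mul_assoc]

/-- A Laurent polynomial without pole at zero and at infinity is constant. -/
theorem exists_eq_C_of_toSeries_mem {k₁ k₂ : ℤ} (h₁ : 0 < k₁) (h₂ : k₂ < 0)
    {a : LaurentPolynomial L} (ha₁ : toSeries L k₁ a ∈ integralSeries L)
    (ha₂ : toSeries L k₂ a ∈ integralSeries L) : ∃ c : L, a = LaurentPolynomial.C c := by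
  refine ⟨a.coeff 0, ?_⟩
  rw [mem_integralSeries] at ha₁ ha₂
  ext i
  rw [LaurentPolynomial.C_apply]
  split_ifs with hi
  · rw [hi]
  · rcases lt_or_gt_of_ne hi with hi | hi
    · rw [← toSeries_coeff k₁ h₁.ne']
      exact ha₁ _ (mul_neg_of_pos_of_neg h₁ hi)
    · rw [← toSeries_coeff k₂ h₂.ne]
      exact ha₂ _ (mul_neg_of_neg_of_pos h₂ hi)

theorem coeff_prod_X_sub_C_mem {R : Type*} [CommRing R] (V : Subring R) (s : Multiset R)
    (hs : ∀ r ∈ s, r ∈ V) (i : ℕ) : ((s.map fun r => X - C r).prod).coeff i ∈ V := by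
  have : (s.map fun r => X - C r).prod ∈ liftsRing V.subtype := by
    refine Subring.multiset_prod_mem _ _ fun p hp => ?_
    obtain ⟨r, hr, rfl⟩ := Multiset.mem_map.1 hp
    exact ⟨X - C ⟨r, hs r hr⟩, by simp⟩
  obtain ⟨q, hq⟩ := this
  rw [← hq]
  simp

end

theorem isIntegrallyClosed_laurentPolynomial (L : Type*) [Field L] :
    IsIntegrallyClosed (LaurentPolynomial L) :=
  isIntegrallyClosed_of_isLocalization (R := L[X]) _ (Submonoid.powers X)
    (powers_le_nonZeroDivisors_of_noZeroDivisors X_ne_zero)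

/-- If `w` is a power series under every extension `σ` of `toSeries L k`, then so are its
conjugates, and hence the coefficients of its minimal polynomial. -/
theorem toSeries_coeff_minpoly_mem {L : Type*} [Field L] (F : Type*) {E : Type*} [Field F]
    [Algebra (LaurentPolynomial L) F] [IsFractionRing (LaurentPolynomial L) F] [Field E]
    [Algebra F E] [Algebra (LaurentPolynomial L) E] [IsScalarTower (LaurentPolynomial L) F E]
    [Normal F E] {k : ℤ}
    (σ : E →+* LaurentSeries L)
    (hσ : σ.comp (algebraMap (LaurentPolynomial L) E) = toSeries L k)
    {w : E} (hw : IsIntegral (LaurentPolynomial L) w)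
    (h : ∀ σ : E →+* LaurentSeries L,
      σ.comp (algebraMap (LaurentPolynomial L) E) = toSeries L k → σ w ∈ integralSeries L) (i : ℕ) :
    toSeries L k ((minpoly (LaurentPolynomial L) w).coeff i) ∈ integralSeries L := by
  have := isIntegrallyClosed_laurentPolynomial L
  set P := minpoly (LaurentPolynomial L) w with hP
  have hmin : minpoly F w = P.map (algebraMap _ F) :=
    minpoly.isIntegrallyClosed_eq_field_fractions (S := E) F E hw
  have hFE : P.map (algebraMap _ E) = (minpoly F w).map (algebraMap F E) := by
    rw [hmin, Polynomial.map_map, ← IsScalarTower.algebraMap_eq]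
  have hsplit : (P.map (algebraMap _ E)).Splits := by
    rw [hFE]; exact Normal.splits inferInstance w
  have hmon : (P.map (algebraMap (LaurentPolynomial L) E)).Monic := (minpoly.monic hw).map _
  rw [← hσ, RingHom.comp_apply, ← coeff_map, hsplit.eq_prod_roots_of_monic hmon, ← coeff_map,
    Polynomial.map_multiset_prod, Multiset.map_map]
  have : (Multiset.map (map σ ∘ fun a => X - C a) (P.map (algebraMap _ E)).roots) =
      ((P.map (algebraMap _ E)).roots.map σ).map fun r => X - C r := by
    rw [Multiset.map_map]
    refine Multiset.map_congr rfl fun a _ => by simp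
  rw [this]
  refine coeff_prod_X_sub_C_mem _ _ (fun r hr => ?_) i
  obtain ⟨a, ha, rfl⟩ := Multiset.mem_map.1 hr
  have hroot : aeval a (minpoly F w) = 0 := by
    rw [mem_roots hmon.ne_zero, hFE, IsRoot, eval_map_algebraMap] at ha
    exact ha
  obtain ⟨τ, hτ⟩ := minpoly.exists_algEquiv_of_root'
    (Algebra.IsAlgebraic.isAlgebraic (R := F) w) hroot
  rw [← hτ]
  refine h (σ.comp τ.toAlgHom.toRingHom) ?_
  rw [← hσ]
  refine RingHom.ext fun x => ?_
  simp [IsScalarTower.algebraMap_apply (LaurentPolynomial L) F E]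

/-- An element that is integral over `L[T;T⁻¹]` and has no poles above zero and infinity is
constant: its minimal polynomial has constant coefficients, and `L` is algebraically closed. -/
theorem exists_eq_algebraMap_C {L : Type*} [Field L] [IsAlgClosed L] (F : Type*)
    {E : Type*} [Field F]
    [Algebra (LaurentPolynomial L) F] [IsFractionRing (LaurentPolynomial L) F] [Field E]
    [Algebra F E] [Algebra (LaurentPolynomial L) E] [IsScalarTower (LaurentPolynomial L) F E]
    [Normal F E] {k₁ k₂ : ℤ} (hk₁ : 0 < k₁) (hk₂ : k₂ < 0)
    (σ₁ σ₂ : E →+* LaurentSeries L)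
    (hσ₁ : σ₁.comp (algebraMap (LaurentPolynomial L) E) = toSeries L k₁)
    (hσ₂ : σ₂.comp (algebraMap (LaurentPolynomial L) E) = toSeries L k₂)
    {w : E} (hw : IsIntegral (LaurentPolynomial L) w)
    (h₁ : ∀ σ : E →+* LaurentSeries L,
      σ.comp (algebraMap (LaurentPolynomial L) E) = toSeries L k₁ → σ w ∈ integralSeries L)
    (h₂ : ∀ σ : E →+* LaurentSeries L,
      σ.comp (algebraMap (LaurentPolynomial L) E) = toSeries L k₂ → σ w ∈ integralSeries L) :
    ∃ c : L, w = algebraMap (LaurentPolynomial L) E (LaurentPolynomial.C c) := by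
  set P := minpoly (LaurentPolynomial L) w with hP
  have hcoef : P ∈ lifts (LaurentPolynomial.C : L →+* LaurentPolynomial L) := by
    rw [lifts_iff_coeff_lifts]
    intro i
    obtain ⟨c, hc⟩ := exists_eq_C_of_toSeries_mem hk₁ hk₂
      (toSeries_coeff_minpoly_mem F σ₁ hσ₁ hw h₁ i)
      (toSeries_coeff_minpoly_mem F σ₂ hσ₂ hw h₂ i)
    exact ⟨c, hc.symm⟩
  obtain ⟨Q, hQ, -, hQm⟩ := lifts_and_natDegree_eq_and_monic hcoef (minpoly.monic hw)
  have h0 : Q.eval₂ ((algebraMap (LaurentPolynomial L) E).comp LaurentPolynomial.C) w = 0 := by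
    rw [← eval₂_map, hQ]
    exact minpoly.aeval _ _
  rw [← eval_map, ((IsAlgClosed.splits Q).eq_prod_roots_of_monic hQm), Polynomial.map_multiset_prod,
    eval_multiset_prod, Multiset.prod_eq_zero_iff] at h0
  simp only [Multiset.map_map, Multiset.mem_map, Function.comp_apply] at h0
  obtain ⟨c, -, hc⟩ := h0
  refine ⟨c, ?_⟩
  simpa [sub_eq_zero] using hc

/-! ### Logarithmic derivatives of roots -/

section

variable {O : Type*} [CommRing O]

theorem isUnit_eval_derivative {G : O[X]} (h : IsCoprime G (derivative G)) {b : O}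
    (hb : G.eval b = 0) : IsUnit ((derivative G).eval b) := by
  obtain ⟨p, q, hpq⟩ := h
  have := congrArg (eval b) hpq
  rw [eval_add, eval_mul, eval_mul, hb, mul_zero, zero_add, eval_one] at this
  exact IsUnit.of_mul_eq_one_right _ this

theorem isUnit_root {G : O[X]} (h : IsUnit (G.coeff 0)) {b : O} (hb : G.eval b = 0) :
    IsUnit b := by
  have := sub_dvd_eval_sub b 0 G
  rw [hb, sub_zero, zero_sub, dvd_neg, ← coeff_zero_eq_eval_zero] at this
  exact isUnit_of_dvd_unit this h

/-- The difference of two roots divides the derivative at one of them, which is a unit. -/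
theorem isUnit_sub_of_roots [IsDomain O] {G : O[X]} (h : IsCoprime G (derivative G)) {b b' : O}
    (hb : G.eval b = 0) (hb' : G.eval b' = 0) (hne : b ≠ b') : IsUnit (b - b') := by
  obtain ⟨Q, hQ⟩ := dvd_iff_isRoot.2 hb'
  have h1 : Q.eval b = 0 := by
    rw [hQ, eval_mul, eval_sub, eval_X, eval_C, mul_eq_zero] at hb
    exact hb.resolve_left (sub_ne_zero.2 hne)
  have h2 : (derivative G).eval b' = Q.eval b' := by
    rw [hQ]; simp
  have h3 := sub_dvd_eval_sub b b' Q
  rw [h1, zero_sub, dvd_neg, ← h2] at h3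
  exact isUnit_of_dvd_unit h3 (isUnit_eval_derivative h hb')

end

/-- A polynomial whose leading coefficient and discriminant are units is coprime to its
derivative. -/
theorem isCoprime_derivative_of_isUnit_discr {R : Type*} [CommRing R] {f : R[X]}
    (hd : 0 < f.natDegree) (hlc : IsUnit f.leadingCoeff) (h : IsUnit f.discr) :
    IsCoprime f (derivative f) := by
  obtain ⟨p, q, -, -, hpq⟩ := exists_mul_add_mul_eq_C_resultant f (derivative f) (m := f.natDegree)
    (n := f.natDegree - 1) le_rfl (natDegree_derivative_le f) (Or.inl hd.ne')
  rw [resultant_deriv (natDegree_pos_iff_degree_pos.1 hd)] at hpq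
  have hu : IsUnit (C ((-1) ^ (f.natDegree * (f.natDegree - 1) / 2) * f.leadingCoeff * f.discr)) :=
    isUnit_C.2 (((isUnit_one.neg.pow _).mul hlc).mul h)
  obtain ⟨u, hu⟩ := hu
  rw [← hu] at hpq
  refine ⟨↑u⁻¹ * p, ↑u⁻¹ * q, ?_⟩
  linear_combination (↑u⁻¹ : R[X]) * hpq + u.inv_mul

/-- The coefficientwise image of a bivariate polynomial under the Euler derivation `x ∂/∂x`. -/
noncomputable def xEuler {L : Type*} [Field L] (f : L[X][Y]) : L[X][Y] :=
  f.sum fun j p => monomial j (X * derivative p)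

theorem xEuler_add {L : Type*} [Field L] (f g : L[X][Y]) :
    xEuler (f + g) = xEuler f + xEuler g :=
  sum_add_index f g _ (by simp) (by simp [mul_add])

theorem xEuler_monomial {L : Type*} [Field L] (j : ℕ) (p : L[X]) :
    xEuler (monomial j p) = monomial j (X * derivative p) :=
  sum_monomial_index p _ (by simp)

section

variable {L : Type*} [Field L]

theorem eulerDeriv_toSeries_toLaurent (k : ℤ) (p : L[X]) :
    eulerDeriv L (toSeries L k (toLaurent p)) =
      HahnSeries.C (k : L) * toSeries L k (toLaurent (X * derivative p)) := by
  induction p using Polynomial.induction_on' with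
  | add p q hp hq => simp only [map_add, mul_add, hp, hq]
  | monomial n r =>
    have h1 : ∀ (n : ℕ) (r : L), toSeries L k (toLaurent (monomial n r)) =
        HahnSeries.single (k * n) r := by
      intro n r
      rw [← C_mul_X_pow_eq_monomial, toLaurent_C_mul_X_pow, toSeries_C_mul_T]
    have h2 : (X : L[X]) * derivative (monomial n r) = monomial n (n * r) := by
      rcases n with _ | n
      · simp
      · rw [derivative_monomial, X_mul_monomial]
        simp [mul_comm]
    rw [h2, h1, h1]
    ext i
    rw [eulerDeriv_coeff, HahnSeries.C_apply, HahnSeries.coeff_single_zero_mul,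
      HahnSeries.coeff_single, HahnSeries.coeff_single]
    split_ifs with hi
    · rw [hi]; push_cast; ring
    · simp

theorem eulerDeriv_pow (a : LaurentSeries L) (n : ℕ) :
    eulerDeriv L (a ^ (n + 1)) = (n + 1 : ℕ) * a ^ n * eulerDeriv L a := by
  induction n with
  | zero => simp
  | succ n ih =>
    rw [pow_succ, eulerDeriv_mul, ih]
    push_cast
    ring

/-- The chain rule for the Euler derivation. The factor `k` comes from `T = s ^ k`, which makes
`s d/ds` restrict to `k` times `T d/dT`. -/
theorem eulerDeriv_eval₂ (k : ℤ) (f : L[X][Y]) (β : LaurentSeries L) :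
    eulerDeriv L ((f.map toLaurent).eval₂ (toSeries L k) β) =
      (derivative (f.map toLaurent)).eval₂ (toSeries L k) β * eulerDeriv L β +
        HahnSeries.C (k : L) * ((xEuler f).map toLaurent).eval₂ (toSeries L k) β := by
  induction f using Polynomial.induction_on' with
  | add p q hp hq =>
    rw [xEuler_add, Polynomial.map_add, Polynomial.map_add, derivative_add, eval₂_add, eval₂_add,
      eval₂_add, map_add, hp, hq]
    ring
  | monomial n p =>
    rw [xEuler_monomial, map_monomial, map_monomial, derivative_monomial, eval₂_monomial,
      eval₂_monomial, eval₂_monomial, eulerDeriv_mul, eulerDeriv_toSeries_toLaurent]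
    rcases n with _ | n
    · simp [eulerDeriv_one]
    · rw [eulerDeriv_pow]
      simp only [map_mul, map_natCast, Nat.add_sub_cancel]
      ring

end

section

variable {A E : Type*} [CommRing A] [Field E] [Algebra A E]

theorem isIntegral_of_isUnit_leadingCoeff {f : A[X]} (hlc : IsUnit f.leadingCoeff) {b : E}
    (hb : aeval b f = 0) : IsIntegral A b := by
  obtain ⟨u, hu⟩ := hlc
  refine ⟨C (↑u⁻¹ : A) * f, ?_, ?_⟩
  · rw [Monic, leadingCoeff_C_mul_of_isUnit u⁻¹.isUnit, ← hu, Units.inv_mul]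
  · change aeval b _ = 0
    rw [map_mul, hb, mul_zero]

theorem isIntegral_inv_of_isUnit {x : integralClosure A E} (hx : IsUnit x) :
    (x : E) ≠ 0 ∧ IsIntegral A (x : E)⁻¹ := by
  obtain ⟨u, rfl⟩ := hx
  have h : ((u : integralClosure A E) : E) *
      ((u⁻¹ : (integralClosure A E)ˣ) : integralClosure A E) = 1 := by
    rw [← MulMemClass.coe_mul, Units.mul_inv, OneMemClass.coe_one]
  refine ⟨left_ne_zero_of_mul_eq_one h, ?_⟩
  rw [inv_eq_of_mul_eq_one_right h]
  exact Subtype.property _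

theorem eval_map_integralClosure (f : A[X]) (x : integralClosure A E) :
    (((f.map (algebraMap A (integralClosure A E))).eval x : integralClosure A E) : E) =
      aeval (x : E) f := by
  rw [eval_map_algebraMap]
  exact (aeval_algebraMap_apply E x f).symm

theorem isIntegral_inv_root {f : A[X]} (hlc : IsUnit f.leadingCoeff) (h0 : IsUnit (f.coeff 0))
    {b : E} (hb : aeval b f = 0) : b ≠ 0 ∧ IsIntegral A b⁻¹ := by
  set x : integralClosure A E := ⟨b, isIntegral_of_isUnit_leadingCoeff hlc hb⟩
  refine isIntegral_inv_of_isUnit (x := x) (isUnit_root (G := f.map (algebraMap A _)) ?_ ?_)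
  · rw [coeff_map]; exact h0.map _
  · exact Subtype.ext ((eval_map_integralClosure f x).trans hb)

theorem isIntegral_inv_derivative {f : A[X]} (hlc : IsUnit f.leadingCoeff)
    (hco : IsCoprime f (derivative f)) {b : E} (hb : aeval b f = 0) :
    aeval b (derivative f) ≠ 0 ∧ IsIntegral A (aeval b (derivative f))⁻¹ := by
  set x : integralClosure A E := ⟨b, isIntegral_of_isUnit_leadingCoeff hlc hb⟩
  have hco' := hco.map (mapRingHom (algebraMap A (integralClosure A E)))
  rw [coe_mapRingHom, ← derivative_map] at hco'
  have := isIntegral_inv_of_isUnit (isUnit_eval_derivative hco'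
    (Subtype.ext ((eval_map_integralClosure f x).trans hb)))
  rwa [derivative_map, eval_map_integralClosure] at this

theorem isIntegral_inv_sub {f : A[X]} (hlc : IsUnit f.leadingCoeff)
    (hco : IsCoprime f (derivative f)) {b b' : E} (hb : aeval b f = 0) (hb' : aeval b' f = 0)
    (hne : b ≠ b') : IsIntegral A (b - b')⁻¹ := by
  set x : integralClosure A E := ⟨b, isIntegral_of_isUnit_leadingCoeff hlc hb⟩
  set x' : integralClosure A E := ⟨b', isIntegral_of_isUnit_leadingCoeff hlc hb'⟩
  have hco' := hco.map (mapRingHom (algebraMap A (integralClosure A E)))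
  rw [coe_mapRingHom, ← derivative_map] at hco'
  exact (isIntegral_inv_of_isUnit (isUnit_sub_of_roots hco'
    (Subtype.ext ((eval_map_integralClosure f x).trans hb))
    (Subtype.ext ((eval_map_integralClosure f x').trans hb'))
    (fun h => hne (congrArg Subtype.val h)))).2

end

theorem C_mem_integralSeries {L : Type*} [Field L] (c : L) :
    (HahnSeries.C c : LaurentSeries L) ∈ integralSeries L := by
  rw [mem_integralSeries]
  intro k hk
  rw [HahnSeries.C_apply, HahnSeries.coeff_single_of_ne hk.ne]

section

variable {L : Type*} [Field L] {E : Type*} [Field E] [Algebra (LaurentPolynomial L) E]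

/-- The derivative, with respect to `x d/dx`, of a root `b` of `f`, by implicit differentiation. -/
noncomputable def rootDeriv (f : L[X][Y]) (b : E) : E :=
  -(aeval b ((xEuler f).map (toLaurent : L[X] →+* LaurentPolynomial L))) /
    aeval b (derivative (f.map (toLaurent : L[X] →+* LaurentPolynomial L)))

/-- In series in `s` with `T = s ^ k`, the derivative `rootDeriv` becomes `k⁻¹ * s d/ds`. -/
theorem eulerDeriv_apply_root {k : ℤ} {σ : E →+* LaurentSeries L}
    (hσ : σ.comp (algebraMap (LaurentPolynomial L) E) = toSeries L k) {f : L[X][Y]} {b : E}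
    (hb : aeval b (f.map (toLaurent : L[X] →+* LaurentPolynomial L)) = 0)
    (hb' : aeval b (derivative (f.map (toLaurent : L[X] →+* LaurentPolynomial L))) ≠ 0) :
    eulerDeriv L (σ b) = HahnSeries.C (k : L) * σ (rootDeriv f b) := by
  have hev : ∀ g : (LaurentPolynomial L)[X], g.eval₂ (toSeries L k) (σ b) = σ (aeval b g) := by
    intro g
    rw [aeval_def, hom_eval₂, hσ]
  have h := eulerDeriv_eval₂ k f (σ b)
  rw [hev, hev, hev, hb, map_zero, map_zero] at h
  have h2 : σ (aeval b (derivative (f.map (toLaurent : L[X] →+* LaurentPolynomial L)))) ≠ 0 := by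
    rwa [_root_.map_ne_zero]
  rw [rootDeriv, map_div₀, map_neg, ← mul_div_assoc, eq_div_iff h2]
  linear_combination -h

theorem isIntegral_rootDeriv {f : L[X][Y]}
    (hlc : IsUnit (f.map (toLaurent : L[X] →+* LaurentPolynomial L)).leadingCoeff)
    (hco : IsCoprime (f.map (toLaurent : L[X] →+* LaurentPolynomial L))
      (derivative (f.map (toLaurent : L[X] →+* LaurentPolynomial L)))) {b : E}
    (hb : aeval b (f.map (toLaurent : L[X] →+* LaurentPolynomial L)) = 0) :
    IsIntegral (LaurentPolynomial L) (rootDeriv f b) := by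
  rw [rootDeriv, div_eq_mul_inv]
  refine IsIntegral.mul (IsIntegral.neg ?_) (isIntegral_inv_derivative hlc hco hb).2
  have := isIntegral_of_isUnit_leadingCoeff hlc hb
  rw [aeval_eq_sum_range]
  exact IsIntegral.sum _ fun i _ => (this.pow i).smul _

theorem apply_mem_of_eulerDeriv {L E : Type*} [Field L] [Field E] {k : ℤ} (hkL : (k : L) ≠ 0)
    {σ : E →+* LaurentSeries L} {x y : E}
    (h : eulerDeriv L (σ x) = HahnSeries.C (k : L) * σ y) : σ (y / x) ∈ integralSeries L := by
  have h1 := mul_mem (C_mem_integralSeries (k : L)⁻¹) (eulerDeriv_div_mem (σ x))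
  rwa [h, mul_div_assoc, ← mul_assoc, ← map_mul, inv_mul_cancel₀ hkL, map_one, one_mul,
    ← map_div₀] at h1

end

theorem exists_extension_to_splittingField {A M : Type*} [CommRing A] [IsDomain A] [Field M]
    (F : Type*) {E : Type*} [Field F] [Algebra A F] [IsFractionRing A F] [Field E]
    [Algebra F E] [Algebra A E] [IsScalarTower A F E] (g : A[X])
    [IsSplittingField F E (g.map (algebraMap A F))] {i : A →+* M} (hi : Function.Injective i)
    (hs : (g.map i).Splits) : ∃ σ : E →+* M, σ.comp (algebraMap A E) = i := by
  obtain ⟨φ, hφ⟩ : ∃ φ : F →+* M, φ.comp (algebraMap A F) = i :=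
    ⟨IsFractionRing.lift hi, RingHom.ext fun x => IsFractionRing.lift_algebraMap hi x⟩
  let _ : Algebra F M := φ.toAlgebra
  have hs' : ((g.map (algebraMap A F)).map (algebraMap F M)).Splits := by
    rw [Polynomial.map_map, RingHom.algebraMap_toAlgebra, hφ]
    exact hs
  refine ⟨(IsSplittingField.lift E (g.map (algebraMap A F)) hs').toRingHom, ?_⟩
  rw [← hφ]
  refine RingHom.ext fun x => ?_
  rw [RingHom.comp_apply, IsScalarTower.algebraMap_apply A F E]
  exact (IsSplittingField.lift E (g.map (algebraMap A F)) hs').commutes _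

/-- The form of `exists_eulerDeriv_root_eq` for a chosen fraction field `F` of `L[T;T⁻¹]` and a
chosen splitting field `E`. -/
theorem exists_eulerDeriv_root_eq_of_splittingField {L : Type*} [Field L] [IsAlgClosed L]
    (F E : Type*) [Field F] [Algebra (LaurentPolynomial L) F]
    [IsFractionRing (LaurentPolynomial L) F] [Field E]
    [Algebra F E] [Algebra (LaurentPolynomial L) E] [IsScalarTower (LaurentPolynomial L) F E]
    {f : L[X][Y]}
    (hlc : IsUnit (f.map (toLaurent : L[X] →+* LaurentPolynomial L)).leadingCoeff)
    (h0 : IsUnit ((f.map (toLaurent : L[X] →+* LaurentPolynomial L)).coeff 0))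
    (hco : IsCoprime (f.map (toLaurent : L[X] →+* LaurentPolynomial L))
      (derivative (f.map (toLaurent : L[X] →+* LaurentPolynomial L))))
    {k₁ k₂ : ℤ} (hk₁ : 0 < k₁) (hk₂ : k₂ < 0) (hkL₁ : (k₁ : L) ≠ 0) (hkL₂ : (k₂ : L) ≠ 0)
    (hs₁ : ((f.map toLaurent).map (toSeries L k₁)).Splits)
    (hs₂ : ((f.map toLaurent).map (toSeries L k₂)).Splits) 
    [IsSplittingField F E ((f.map toLaurent).map (algebraMap (LaurentPolynomial L) F))] :
    ∃ c : L, ∀ β ∈ ((f.map toLaurent).map (toSeries L k₁)).roots,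
      eulerDeriv L β = HahnSeries.C c * β := by
  set g : (LaurentPolynomial L)[X] := f.map toLaurent with hg
  have : Normal F E := Normal.of_isSplittingField (g.map (algebraMap (LaurentPolynomial L) F))
  obtain ⟨σ₁, hσ₁⟩ := exists_extension_to_splittingField F (E := E) g
    (toSeries_injective hk₁.ne') hs₁
  obtain ⟨σ₂, hσ₂⟩ := exists_extension_to_splittingField F (E := E) g
    (toSeries_injective hk₂.ne) hs₂
  have hC : ∀ c : L, σ₁ (algebraMap (LaurentPolynomial L) E (LaurentPolynomial.C c)) =
      HahnSeries.C c := by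
    intro c
    rw [← RingHom.comp_apply, hσ₁, toSeries, LaurentPolynomial.eval₂_C]
  have hderiv : ∀ b : E, aeval b g = 0 → aeval b (derivative g) ≠ 0 := fun b hb =>
    (isIntegral_inv_derivative hlc hco hb).1
  -- the logarithmic derivative of a root is constant
  have hlog : ∀ b : E, aeval b g = 0 → ∃ c : L,
      rootDeriv f b = algebraMap (LaurentPolynomial L) E (LaurentPolynomial.C c) * b := by
    intro b hb
    obtain ⟨hb0, hbi⟩ := isIntegral_inv_root hlc h0 hb
    obtain ⟨c, hc⟩ := exists_eq_algebraMap_C F hk₁ hk₂ σ₁ σ₂ hσ₁ hσ₂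
      (w := rootDeriv f b / b)
      (by rw [div_eq_mul_inv]; exact (isIntegral_rootDeriv hlc hco hb).mul hbi)
      (fun σ hσ => apply_mem_of_eulerDeriv hkL₁
        (eulerDeriv_apply_root hσ hb (hderiv b hb)))
      (fun σ hσ => apply_mem_of_eulerDeriv hkL₂
        (eulerDeriv_apply_root hσ hb (hderiv b hb)))
    exact ⟨c, by rw [← hc, div_mul_cancel₀ _ hb0]⟩
  -- so is the logarithmic derivative of a difference of two roots
  have hlog2 : ∀ b b' : E, aeval b g = 0 → aeval b' g = 0 → b ≠ b' → ∃ c : L,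
      rootDeriv f b - rootDeriv f b' =
        algebraMap (LaurentPolynomial L) E (LaurentPolynomial.C c) * (b - b') := by
    intro b b' hb hb' hne
    have hd : ∀ {k : ℤ} {σ : E →+* LaurentSeries L}, k ≠ 0 →
        σ.comp (algebraMap (LaurentPolynomial L) E) = toSeries L k →
        eulerDeriv L (σ (b - b')) =
          HahnSeries.C (k : L) * σ (rootDeriv f b - rootDeriv f b') := by
      intro k σ hk hσ
      rw [map_sub, map_sub, map_sub, mul_sub, eulerDeriv_apply_root hσ hb (hderiv b hb),
        eulerDeriv_apply_root hσ hb' (hderiv b' hb')]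
    obtain ⟨c, hc⟩ := exists_eq_algebraMap_C F hk₁ hk₂ σ₁ σ₂ hσ₁ hσ₂
      (w := (rootDeriv f b - rootDeriv f b') / (b - b'))
      (by
        rw [div_eq_mul_inv]
        exact ((isIntegral_rootDeriv hlc hco hb).sub (isIntegral_rootDeriv hlc hco hb')).mul
          (isIntegral_inv_sub hlc hco hb hb' hne))
      (fun σ hσ => apply_mem_of_eulerDeriv hkL₁ (hd hk₁.ne' hσ))
      (fun σ hσ => apply_mem_of_eulerDeriv hkL₂ (hd hk₂.ne hσ))
    exact ⟨c, by rw [← hc, div_mul_cancel₀ _ (sub_ne_zero.2 hne)]⟩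
  have hinj : Function.Injective (HahnSeries.C : L →+* LaurentSeries L) := HahnSeries.C_injective
  have hδ : ∀ (b : E) (c : L), aeval b g = 0 →
      rootDeriv f b = algebraMap (LaurentPolynomial L) E (LaurentPolynomial.C c) * b →
      eulerDeriv L (σ₁ b) = HahnSeries.C (k₁ : L) * (HahnSeries.C c * σ₁ b) := by
    intro b c hb hc
    rw [eulerDeriv_apply_root hσ₁ hb (hderiv b hb), hc, map_mul, hC]
  have huniq : ∀ (b b' : E) (c c' : L), aeval b g = 0 → aeval b' g = 0 →
      rootDeriv f b = algebraMap (LaurentPolynomial L) E (LaurentPolynomial.C c) * b →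
      rootDeriv f b' = algebraMap (LaurentPolynomial L) E (LaurentPolynomial.C c') * b' →
      b ≠ b' → c = c' := by
    intro b b' c c' hb hb' hc hc' hne
    obtain ⟨d, hd⟩ := hlog2 b b' hb hb' hne
    have hrel : HahnSeries.C (c - d) * σ₁ b = HahnSeries.C (c' - d) * σ₁ b' := by
      have := congrArg σ₁ hd
      rw [hc, hc', map_sub, map_mul, map_mul, map_mul, map_sub, hC, hC, hC] at this
      rw [map_sub, map_sub]
      linear_combination this
    -- a linear relation over `L` between two eigenvectors of the Euler derivation
    have hrel2 := congrArg (eulerDeriv L) hrel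
    rw [eulerDeriv_C_mul, eulerDeriv_C_mul, hδ b c hb hc, hδ b' c' hb' hc'] at hrel2
    have hb0 : σ₁ b ≠ 0 := by
      rw [_root_.map_ne_zero]; exact (isIntegral_inv_root hlc h0 hb).1
    have hb0' : σ₁ b' ≠ 0 := by
      rw [_root_.map_ne_zero]; exact (isIntegral_inv_root hlc h0 hb').1
    have e1 : HahnSeries.C ((k₁ : L) * (c - d) * (c - c')) * σ₁ b = 0 := by
      simp only [map_mul, map_sub] at hrel hrel2 ⊢
      linear_combination hrel2 - HahnSeries.C (k₁ : L) * HahnSeries.C c' * hrel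
    have e2 : HahnSeries.C ((k₁ : L) * (c' - d) * (c - c')) * σ₁ b' = 0 := by
      simp only [map_mul, map_sub] at hrel hrel2 ⊢
      linear_combination hrel2 - HahnSeries.C (k₁ : L) * HahnSeries.C c * hrel
    rw [mul_eq_zero, or_iff_left hb0, map_eq_zero_iff _ hinj] at e1
    rw [mul_eq_zero, or_iff_left hb0', map_eq_zero_iff _ hinj] at e2
    by_contra hcc
    have f1 : c - d = 0 := by simpa [hkL₁, sub_ne_zero.2 hcc] using e1
    have f2 : c' - d = 0 := by simpa [hkL₁, sub_ne_zero.2 hcc] using e2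
    exact hcc (by linear_combination f1 - f2)
  -- every root in the series field comes from the splitting field
  have hg0 : g ≠ 0 := by rintro h; simp [h] at hlc
  have hsplit : (g.map (algebraMap (LaurentPolynomial L) E)).Splits := by
    rw [IsScalarTower.algebraMap_eq (LaurentPolynomial L) F E, ← Polynomial.map_map]
    exact IsSplittingField.splits E _
  have hroots : ∀ β ∈ (g.map (toSeries L k₁)).roots, ∃ b : E, aeval b g = 0 ∧ σ₁ b = β := by
    intro β hβ
    rw [← hσ₁, ← Polynomial.map_map, hsplit.roots_map, Multiset.mem_map] at hβ
    obtain ⟨b, hb, rfl⟩ := hβ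
    refine ⟨b, ?_, rfl⟩
    have := isRoot_of_mem_roots hb
    rwa [IsRoot, eval_map_algebraMap] at this
  by_cases hex : ∃ b : E, aeval b g = 0
  · obtain ⟨b, hb⟩ := hex
    obtain ⟨c, hc⟩ := hlog b hb
    refine ⟨k₁ * c, fun β hβ => ?_⟩
    obtain ⟨b', hb', rfl⟩ := hroots β hβ
    obtain ⟨c', hc'⟩ := hlog b' hb'
    have hcc : c' = c := by
      by_cases hne : b' = b
      · subst hne
        have := congrArg σ₁ (hc.symm.trans hc')
        rw [map_mul, map_mul, hC, hC] at this
        have hb0 : σ₁ b' ≠ 0 := by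
          rw [_root_.map_ne_zero]; exact (isIntegral_inv_root hlc h0 hb').1
        exact (hinj (mul_right_cancel₀ hb0 this)).symm
      · exact huniq b' b c' c hb' hb hc' hc hne
    rw [hδ b' c' hb' hc', hcc, map_mul, mul_assoc]
  · refine ⟨0, fun β hβ => ?_⟩
    obtain ⟨b, hb, -⟩ := hroots β hβ
    exact absurd ⟨b, hb⟩ hex

/-- All roots of `f` in a field of Laurent series are eigenvectors of the Euler derivation, for
the same eigenvalue. -/
theorem exists_eulerDeriv_root_eq {L : Type*} [Field L] [IsAlgClosed L] {f : L[X][Y]}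
    (hlc : IsUnit (f.map (toLaurent : L[X] →+* LaurentPolynomial L)).leadingCoeff)
    (h0 : IsUnit ((f.map (toLaurent : L[X] →+* LaurentPolynomial L)).coeff 0))
    (hco : IsCoprime (f.map (toLaurent : L[X] →+* LaurentPolynomial L))
      (derivative (f.map (toLaurent : L[X] →+* LaurentPolynomial L))))
    {k₁ k₂ : ℤ} (hk₁ : 0 < k₁) (hk₂ : k₂ < 0) (hkL₁ : (k₁ : L) ≠ 0) (hkL₂ : (k₂ : L) ≠ 0)
    (hs₁ : ((f.map toLaurent).map (toSeries L k₁)).Splits)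
    (hs₂ : ((f.map toLaurent).map (toSeries L k₂)).Splits) :
    ∃ c : L, ∀ β ∈ ((f.map toLaurent).map (toSeries L k₁)).roots,
      eulerDeriv L β = HahnSeries.C c * β :=
  exists_eulerDeriv_root_eq_of_splittingField (FractionRing (LaurentPolynomial L))
    ((f.map toLaurent).map (algebraMap (LaurentPolynomial L)
      (FractionRing (LaurentPolynomial L)))).SplittingField hlc h0 hco hk₁ hk₂ hkL₁ hkL₂ hs₁ hs₂

/-! ### Exponents of a polynomial with monomial discriminant -/

/-- The discriminant commutes with ring homomorphisms that preserve the degree. -/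
theorem discr_map {R S : Type*} [CommRing R] [CommRing S] [IsDomain S] (φ : R →+* S) (f : R[X])
    (h : φ f.leadingCoeff ≠ 0) : (f.map φ).discr = φ f.discr := by
  rcases Nat.eq_zero_or_pos f.natDegree with h0 | h0
  -- the resultant with the derivative does not determine the discriminant of a constant
  · rw [eq_C_of_natDegree_eq_zero h0, map_C, discr_C, discr_C, map_one]
  · have hd : (f.map φ).natDegree = f.natDegree := natDegree_map_of_leadingCoeff_ne_zero φ h
    have e1 := resultant_deriv (natDegree_pos_iff_degree_pos.1 h0)
    have e2 := resultant_deriv (natDegree_pos_iff_degree_pos.1 (hd.symm ▸ h0))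
    rw [hd, leadingCoeff_map_of_leadingCoeff_ne_zero φ h, derivative_map, resultant_map_map, e1,
      map_mul, map_mul, map_pow, map_neg, map_one] at e2
    exact (mul_left_cancel₀ (mul_ne_zero (pow_ne_zero _ (neg_ne_zero.2 one_ne_zero)) h) e2).symm

section

variable {L : Type*} [Field L]

/-- If the Euler derivation acts by `c` on all roots, then it acts by `k * c` on their `k`-th
elementary symmetric function. -/
theorem eulerDeriv_coeff_prod (c : L) (s : Multiset (LaurentSeries L))
    (hs : ∀ β ∈ s, eulerDeriv L β = HahnSeries.C c * β) (j : ℕ) :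
    eulerDeriv L (((s.map fun β => X - C β).prod).coeff j) =
      HahnSeries.C (((Multiset.card s : L) - j) * c) * ((s.map fun β => X - C β).prod).coeff j := by
  induction s using Multiset.induction_on generalizing j with
  | empty =>
    rw [Multiset.map_zero, Multiset.prod_zero, coeff_one]
    split_ifs with h
    · simp [h, eulerDeriv_one]
    · simp
  | cons β s ih =>
    have ih' := ih fun γ hγ => hs γ (Multiset.mem_cons_of_mem hγ)
    have hβ := hs β (Multiset.mem_cons_self β s)
    rw [Multiset.map_cons, Multiset.prod_cons, sub_mul, coeff_sub, coeff_C_mul, map_sub,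
      eulerDeriv_mul, ih', hβ, Multiset.card_cons]
    rcases j with _ | j
    · rw [coeff_X_mul_zero, map_zero]
      simp only [map_mul, map_sub, Nat.cast_add, map_add, Nat.cast_zero, Nat.cast_one, map_zero,
        map_one]
      ring
    · rw [coeff_X_mul, ih']
      simp only [map_mul, map_sub, Nat.cast_add, map_add, Nat.cast_one, map_one]
      ring

theorem isUnit_toLaurent_of_isNonzeroMonomial {p : L[X]} (h : IsNonzeroMonomial p) :
    IsUnit (toLaurent p) := by
  obtain ⟨k, c, hc, rfl⟩ := h
  rw [← C_mul_X_pow_eq_monomial, toLaurent_C_mul_X_pow]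
  exact ((isUnit_iff_ne_zero.2 hc).map LaurentPolynomial.C).mul (LaurentPolynomial.isUnit_T k)

theorem isCoprime_derivative_of_isNonzeroMonomial_discr {f : L[X][Y]} (hn : 0 < f.natDegree)
    (hlc : IsNonzeroMonomial f.leadingCoeff) (hd : IsNonzeroMonomial f.discr) :
    IsCoprime (f.map (toLaurent : L[X] →+* LaurentPolynomial L))
      (derivative (f.map (toLaurent : L[X] →+* LaurentPolynomial L))) := by
  have hu := isUnit_toLaurent_of_isNonzeroMonomial hlc
  have hne := hu.ne_zero
  refine isCoprime_derivative_of_isUnit_discr ?_ ?_ ?_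
  · rwa [natDegree_map_of_leadingCoeff_ne_zero _ hne]
  · rwa [leadingCoeff_map_of_leadingCoeff_ne_zero _ hne]
  · rw [discr_map _ _ hne]
    exact isUnit_toLaurent_of_isNonzeroMonomial hd

end

/-- The exponents of `f` satisfy a linear relation within the field of coefficients. -/
theorem exists_exponent_relation {L : Type*} [Field L] [IsAlgClosed L] {f : L[X][Y]}
    (hn : 0 < f.natDegree) (hnL : ∀ k : ℕ, 0 < k → k ≤ f.natDegree → (k : L) ≠ 0)
    (h0 : IsNonzeroMonomial (f.coeff 0)) {kₙ : ℕ} {cₙ : L} (hcₙ : cₙ ≠ 0)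
    (hlc : f.leadingCoeff = monomial kₙ cₙ) (hd : IsNonzeroMonomial f.discr) :
    ∃ c : L, ∀ i j : ℕ, (f.coeff j).coeff i ≠ 0 → (i : L) = kₙ + (f.natDegree - j) * c := by
  have hco := isCoprime_derivative_of_isNonzeroMonomial_discr hn ⟨kₙ, cₙ, hcₙ, hlc⟩ hd
  have hu := isUnit_toLaurent_of_isNonzeroMonomial (p := f.leadingCoeff) ⟨kₙ, cₙ, hcₙ, hlc⟩
  set g : (LaurentPolynomial L)[X] := f.map toLaurent with hg
  have hglc : g.leadingCoeff = toLaurent f.leadingCoeff :=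
    leadingCoeff_map_of_leadingCoeff_ne_zero _ hu.ne_zero
  have hgd : g.natDegree = f.natDegree := natDegree_map_of_leadingCoeff_ne_zero _ hu.ne_zero
  have hsplits : ∀ k : ℤ, ∃ N : ℕ, 0 < N ∧ (N : L) ≠ 0 ∧ (g.map (toSeries L (N * k))).Splits := by
    intro k
    obtain ⟨N, hN, hNL, hs⟩ := exists_splits_ramify f.natDegree hnL (g.map (toSeries L k))
      (natDegree_map_le.trans hgd.le)
    refine ⟨N, NeZero.pos N, hNL, ?_⟩
    rwa [Polynomial.map_map, ramify_comp_toSeries] at hs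
  obtain ⟨N₁, hN₁, hNL₁, hs₁⟩ := hsplits 1
  obtain ⟨N₂, hN₂, hNL₂, hs₂⟩ := hsplits (-1)
  rw [mul_one] at hs₁
  have hN₁' : (N₁ : ℤ) ≠ 0 := by exact_mod_cast hN₁.ne'
  obtain ⟨c, hc⟩ := exists_eulerDeriv_root_eq (hglc ▸ hu)
    (by rw [coeff_map]; exact isUnit_toLaurent_of_isNonzeroMonomial h0) hco
    (k₁ := N₁) (k₂ := N₂ * -1) (by exact_mod_cast hN₁) (by simpa using hN₂)
    (by exact_mod_cast hNL₁) (by simpa using hNL₂) hs₁ hs₂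
  refine ⟨c / N₁, fun i j hij => ?_⟩
  have hprod := hs₁.eq_prod_roots
  have hcard := hs₁.natDegree_eq_card_roots
  have hlc' : (g.map (toSeries L N₁)).leadingCoeff = HahnSeries.single (N₁ * kₙ : ℤ) cₙ := by
    rw [leadingCoeff_map_of_injective (toSeries_injective hN₁'), hglc, hlc,
      ← C_mul_X_pow_eq_monomial, toLaurent_C_mul_X_pow, toSeries_C_mul_T]
  have hcard' : Multiset.card (g.map (toSeries L N₁)).roots = f.natDegree := by
    rw [← hcard, natDegree_map_eq_of_injective (toSeries_injective hN₁'), hgd]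
  have hsingle : eulerDeriv L (HahnSeries.single (N₁ * kₙ : ℤ) cₙ) =
      HahnSeries.C ((N₁ * kₙ : L)) * HahnSeries.single (N₁ * kₙ : ℤ) cₙ := by
    ext m
    rw [eulerDeriv_coeff, HahnSeries.C_apply, HahnSeries.coeff_single_zero_mul,
      HahnSeries.coeff_single]
    split_ifs with hm
    · rw [hm]; push_cast; ring
    · simp
  have hcoef : eulerDeriv L ((g.map (toSeries L N₁)).coeff j) =
      HahnSeries.C (N₁ * kₙ + (f.natDegree - j) * c : L) * (g.map (toSeries L N₁)).coeff j := by
    have h1 : (g.map (toSeries L N₁)).coeff j = HahnSeries.single (N₁ * kₙ : ℤ) cₙ *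
        (((g.map (toSeries L N₁)).roots.map fun β => X - C β).prod).coeff j := by
      rw [← hlc', ← coeff_C_mul, ← hprod]
    rw [h1, eulerDeriv_mul, hsingle, eulerDeriv_coeff_prod c _ hc, hcard', map_add]
    ring
  have := congrArg (fun a : LaurentSeries L => a.coeff (N₁ * i : ℤ)) hcoef
  rw [eulerDeriv_coeff, HahnSeries.C_apply, HahnSeries.coeff_single_zero_mul, coeff_map, hg,
    coeff_map, toSeries_coeff _ hN₁'] at this
  have h2 : (toLaurent (f.coeff j)).coeff (i : ℤ) = (f.coeff j).coeff i := by
    rw [LaurentPolynomial.coeff_toLaurent]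
    exact Finsupp.mapDomain_apply Nat.castEmbedding.injective _ i
  rw [h2] at this
  have h3 := mul_right_cancel₀ hij this
  push_cast at h3
  field_simp
  linear_combination h3

theorem natDegree_le_of_totalDegreeLE {K : Type*} [Field K] {f : K[X][Y]} {d : ℕ}
    (hd : TotalDegreeLE f d) : f.natDegree ≤ d := by
  by_cases hf : f = 0
  · simp [hf]
  · have h1 : f.leadingCoeff ≠ 0 := leadingCoeff_ne_zero.2 hf
    have h2 : f.leadingCoeff.leadingCoeff ≠ 0 := leadingCoeff_ne_zero.2 h1
    exact le_of_add_le_right (hd _ _ h2)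

/-- If integers of absolute value at most `2 * d ^ 2 + d` are detected by `L`, then the relation
between the exponents holds in `ℤ`. -/
theorem isQuasiHomogeneous_of_isNonzeroMonomial {L : Type*} [Field L] [IsAlgClosed L]
    {f : L[X][Y]} {d : ℕ} (hd : TotalDegreeLE f d)
    (hchar : ∀ z : ℤ, |z| ≤ 2 * d ^ 2 + d → (z : L) = 0 → z = 0)
    (h0 : IsNonzeroMonomial (f.coeff 0)) (hlc : IsNonzeroMonomial f.leadingCoeff)
    (hdisc : IsNonzeroMonomial f.discr) : IsQuasiHomogeneousWithXWeight f := by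
  obtain ⟨k₀, c₀, hc₀, e₀⟩ := h0
  rcases Nat.eq_zero_or_pos f.natDegree with hn | hn
  · refine ⟨k₀, 1, 0, one_ne_zero, fun i j hij => ?_⟩
    have hj : j = 0 := by
      by_contra hj
      rw [coeff_eq_zero_of_natDegree_lt (p := f) (by omega)] at hij
      simp at hij
    rw [hj, e₀, coeff_monomial] at hij
    have : k₀ = i := by by_contra h; simp [h] at hij
    simp [this]
  · obtain ⟨kₙ, cₙ, hcₙ, eₙ⟩ := hlc
    have hnd := natDegree_le_of_totalDegreeLE hd
    have hnL : ∀ k : ℕ, 0 < k → k ≤ f.natDegree → (k : L) ≠ 0 := by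
      intro k hk hk' h
      have := hchar k (by rw [Nat.abs_cast]; norm_cast; nlinarith) (by exact_mod_cast h)
      omega
    obtain ⟨c, hc⟩ := exists_exponent_relation hn hnL ⟨k₀, c₀, hc₀, e₀⟩ hcₙ eₙ hdisc
    have hk₀ : (f.coeff 0).coeff k₀ ≠ 0 := by rw [e₀, coeff_monomial_same]; exact hc₀
    have hkₙ : (f.coeff f.natDegree).coeff kₙ ≠ 0 := by
      change f.leadingCoeff.coeff kₙ ≠ 0
      rw [eₙ, coeff_monomial_same]; exact hcₙ
    refine ⟨f.natDegree * k₀, f.natDegree, k₀ - kₙ, by exact_mod_cast hn.ne', fun i j hij => ?_⟩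
    have hj : j ≤ f.natDegree := by
      by_contra hj
      rw [coeff_eq_zero_of_natDegree_lt (p := f) (not_le.1 hj)] at hij
      simp at hij
    have r0 := hc k₀ 0 hk₀
    have r1 := hc i j hij
    have b0 := hd _ _ hk₀
    have b1 := hd _ _ hkₙ
    have b2 := hd _ _ hij
    generalize f.natDegree = n at *
    -- `c` is eliminated between the relations for `x ^ i * y ^ j` and for `x ^ k₀`
    have hz := hchar (n * ((i : ℤ) - kₙ) - (n - j) * ((k₀ : ℤ) - kₙ)) ?_ ?_
    · linarith
    · have a1 : |(n : ℤ) * ((i : ℤ) - kₙ)| ≤ d * d := by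
        rw [abs_mul]
        refine mul_le_mul ?_ ?_ (abs_nonneg _) (by positivity)
        · rw [Nat.abs_cast]; exact_mod_cast hnd
        · rw [abs_le]; constructor <;> omega
      have a2 : |((n : ℤ) - j) * ((k₀ : ℤ) - kₙ)| ≤ d * d := by
        rw [abs_mul]
        refine mul_le_mul ?_ ?_ (abs_nonneg _) (by positivity)
        · rw [abs_le]; constructor <;> omega
        · rw [abs_le]; constructor <;> omega
      have := abs_sub ((n : ℤ) * ((i : ℤ) - kₙ)) ((n - j) * ((k₀ : ℤ) - kₙ))
      nlinarith
    · push_cast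
      push_cast at r0
      linear_combination (n : L) * r1 - ((n : L) - j) * r0

/-! ### Zeros of the discriminant -/

/-- The discriminant detects a common factor with the derivative, even where the derivative drops
degree. -/
theorem discr_ne_zero_iff_isCoprime {k : Type*} [Field k] {f : k[X]} (hf : f ≠ 0)
    (hn : 0 < f.natDegree) : f.discr ≠ 0 ↔ IsCoprime f (derivative f) := by
  have hlc : f.leadingCoeff ≠ 0 := leadingCoeff_ne_zero.2 hf
  refine ⟨fun h => isCoprime_derivative_of_isUnit_discr hn hlc.isUnit h.isUnit, fun h hd => ?_⟩
  have h1 := resultant_deriv (natDegree_pos_iff_degree_pos.1 hn)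
  obtain ⟨m, hm⟩ := Nat.exists_eq_add_of_le (natDegree_derivative_le f)
  rw [hd, mul_zero, hm, resultant_add_right_deg _ _ _ _ _ le_rfl, mul_eq_zero,
    coeff_natDegree, or_iff_right (pow_ne_zero _ hlc)] at h1
  exact resultant_ne_zero f (derivative f) h h1

theorem discr_ne_zero_of_natDegree_eq_zero {R : Type*} [CommRing R] [Nontrivial R] {f : R[X]}
    (h : f.natDegree = 0) : f.discr ≠ 0 := by
  rw [eq_C_of_natDegree_eq_zero h, discr_C]
  exact one_ne_zero

/-- A squarefree polynomial has a nonzero discriminant if all positive integers up to its degree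
are invertible, by Gauss's lemma and as then all irreducible factors are separable. -/
theorem discr_ne_zero_of_squarefree {K : Type*} [Field K] {f : K[X][Y]} (hf : Squarefree f)
    (hK : ∀ k : ℕ, 0 < k → k ≤ f.natDegree → (k : K) ≠ 0) : f.discr ≠ 0 := by
  rcases Nat.eq_zero_or_pos f.natDegree with hn | hn
  · exact discr_ne_zero_of_natDegree_eq_zero hn
  have hf0 : f ≠ 0 := by rintro rfl; simp at hn
  let F := FractionRing K[X]
  let i : K[X] →+* F := algebraMap K[X] F
  have hi : Function.Injective i := IsFractionRing.injective K[X] F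
  have hlc : i f.leadingCoeff ≠ 0 := by
    rw [map_ne_zero_iff _ hi]; exact leadingCoeff_ne_zero.2 hf0
  have hnF : (f.map i).natDegree = f.natDegree := natDegree_map_eq_of_injective hi f
  have hfF : f.map i ≠ 0 := (Polynomial.map_ne_zero_iff hi).2 hf0
  suffices H : (f.map i).discr ≠ 0 by
    rw [discr_map i f hlc] at H
    exact fun h => H (by rw [h, map_zero])
  rw [discr_ne_zero_iff_isCoprime hfF (hnF.symm ▸ hn)]
  refine isCoprime_of_irreducible_dvd (fun h => hfF h.1) fun q hq hqf hqf' => ?_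
  obtain ⟨h, hh⟩ := hqf
  have hq0 := hq.ne_zero
  have hqd : 0 < q.natDegree := hq.natDegree_pos
  have hq' : derivative q ≠ 0 := by
    intro hz
    have h1 := congrArg (fun p => coeff p (q.natDegree - 1)) hz
    simp only [coeff_derivative, coeff_zero, mul_eq_zero] at h1
    rw [Nat.sub_add_cancel hqd] at h1
    rcases h1 with h1 | h1
    · exact hq0 (leadingCoeff_eq_zero.1 h1)
    · refine hK q.natDegree hqd ?_ ?_
      · rw [← hnF]; exact natDegree_le_of_dvd ⟨h, hh⟩ hfF
      · have h2 : ((q.natDegree : ℕ) : F) = 0 := by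
          rw [← h1]
          have : q.natDegree = q.natDegree - 1 + 1 := by omega
          conv_lhs => rw [this]
          push_cast
          rfl
        have h3 : algebraMap K F (q.natDegree : K) = 0 := by rw [map_natCast, h2]
        exact (map_eq_zero _).1 h3
  have hqh : q ∣ h := by
    have h1 : q ∣ derivative q * h := by
      rw [hh, derivative_mul] at hqf'
      exact (dvd_add_left (dvd_mul_right _ _)).1 hqf'
    refine (hq.prime.dvd_or_dvd h1).resolve_left fun h2 => ?_
    exact absurd (natDegree_le_of_dvd h2 hq')
      (not_le.2 ((natDegree_derivative_lt hqd.ne')))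
  have hsq : q * q ∣ f.map i := by rw [hh]; exact mul_dvd_mul_left q hqh
  -- the primitive part `N.primPart` of a multiple of `q` has a square dividing `f` in `K[X][Y]`
  obtain ⟨_⟩ : Nonempty (NormalizedGCDMonoid K[X]) := inferInstance
  obtain ⟨b, hb, hN⟩ := IsLocalization.integerNormalization_spec (nonZeroDivisors K[X]) q
  set N := IsLocalization.integerNormalization (nonZeroDivisors K[X]) q
  have hib : i b ≠ 0 := (map_ne_zero_iff _ hi).2 (nonZeroDivisors.ne_zero hb)
  have hNq : N.map i = C (i b) * q := by
    rw [hN, ← smul_eq_C_mul]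
    exact (algebraMap_smul F b q).symm
  have hN0 : N ≠ 0 := by
    intro h0
    rw [h0, Polynomial.map_zero] at hNq
    exact mul_ne_zero (C_ne_zero.2 hib) hq0 hNq.symm
  have hdvd : N.primPart.map i ∣ q := by
    have h1 : N.primPart.map i ∣ N.map i := Polynomial.map_dvd i (primPart_dvd N)
    rw [hNq] at h1
    exact (isUnit_C.2 hib.isUnit).dvd_mul_left.1 h1
  have hdvd2 : N.primPart * N.primPart ∣ f := by
    refine IsPrimitive.dvd_of_fraction_map_dvd_fraction_map (K := F)
      (N.isPrimitive_primPart.mul N.isPrimitive_primPart) ?_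
    rw [Polynomial.map_mul]
    exact (mul_dvd_mul hdvd hdvd).trans hsq
  have hunit := natDegree_eq_zero_of_isUnit (hf _ hdvd2)
  have hNd : N.natDegree = q.natDegree := by
    rw [← natDegree_map_eq_of_injective hi N, hNq, natDegree_C_mul hib]
  rw [natDegree_primPart] at hunit
  omega

section

variable {K : Type*} [Field K]

theorem isNonzeroMonomial_of_coeff {p : K[X]} (hp : p ≠ 0)
    (h : ∀ i i', p.coeff i ≠ 0 → p.coeff i' ≠ 0 → i = i') : IsNonzeroMonomial p := by
  have hlc := leadingCoeff_ne_zero.2 hp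
  refine ⟨p.natDegree, p.leadingCoeff, hlc, ?_⟩
  ext i
  rw [coeff_monomial]
  split_ifs with hi
  · rw [← hi]; rfl
  · by_contra hne
    exact hi (h _ _ hlc hne)

/-- Nonzero monomials are the polynomials without roots outside of zero. -/
theorem isNonzeroMonomial_iff (L : Type*) [Field L] [IsAlgClosed L] [Algebra K L] {p : K[X]} :
    IsNonzeroMonomial p ↔ ∀ a : L, a ≠ 0 → aeval a p ≠ 0 := by
  constructor
  · rintro ⟨k, c, hc, rfl⟩ a ha
    rw [aeval_monomial]
    exact mul_ne_zero ((_root_.map_ne_zero _).2 hc) (pow_ne_zero k ha)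
  · intro h
    have hp : p ≠ 0 := by rintro rfl; simpa using h 1 one_ne_zero
    obtain ⟨q, hq, hX⟩ := exists_eq_pow_rootMultiplicity_mul_and_not_dvd p hp 0
    rw [C_0, sub_zero] at hq hX
    have hq0 : q.degree = 0 := by
      by_contra hd
      obtain ⟨a, ha⟩ := IsAlgClosed.exists_aeval_eq_zero L q hd
      by_cases ha0 : a = 0
      · rw [ha0, ← coeff_zero_eq_aeval_zero', map_eq_zero] at ha
        exact hX (X_dvd_iff.2 ha)
      · exact h a ha0 (by rw [hq, map_mul, ha, mul_zero])
    rw [eq_C_of_degree_eq_zero hq0] at hq hX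
    refine ⟨rootMultiplicity 0 p, q.coeff 0, ?_, ?_⟩
    · intro h0
      rw [h0, C_0] at hX
      exact hX (dvd_zero _)
    · rw [← C_mul_X_pow_eq_monomial, mul_comm]
      exact hq

variable {L : Type*} [Field L] [Algebra K L]

/-- The polynomial `f(a, y)` in `y`. -/
noncomputable def specialize (f : K[X][Y]) (a : L) : L[X] :=
  f.map (aeval a : K[X] →ₐ[K] L).toRingHom

theorem specialize_coeff (f : K[X][Y]) (a : L) (j : ℕ) :
    (specialize f a).coeff j = aeval a (f.coeff j) := coeff_map _ _

theorem specialize_natDegree_le (f : K[X][Y]) (a : L) :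
    (specialize f a).natDegree ≤ f.natDegree := natDegree_map_le

/-- Where the leading coefficient of `f` does not vanish, the zeros of the discriminant are the
values of `x` with a multiple root `y`. -/
theorem aeval_discr_eq_zero_iff [IsAlgClosed L] {f : K[X][Y]} {a : L}
    (hlc : aeval a f.leadingCoeff ≠ 0) :
    aeval a f.discr = 0 ↔
      ∃ y : L, (specialize f a).eval y = 0 ∧ (derivative (specialize f a)).eval y = 0 := by
  have h1 : (specialize f a).discr = aeval a f.discr := discr_map _ f hlc
  have hd : (specialize f a).natDegree = f.natDegree := natDegree_map_of_leadingCoeff_ne_zero _ hlc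
  have h0 : specialize f a ≠ 0 := by
    intro h
    have := specialize_coeff f a f.natDegree
    rw [h, coeff_zero] at this
    exact hlc this.symm
  rw [← h1]
  rcases Nat.eq_zero_or_pos f.natDegree with hn | hn
  · rw [hn] at hd
    refine iff_of_false (discr_ne_zero_of_natDegree_eq_zero hd) ?_
    rintro ⟨y, hy, -⟩
    rw [eq_C_of_natDegree_eq_zero hd, eval_C] at hy
    exact h0 (by rw [eq_C_of_natDegree_eq_zero hd, hy, C_0])
  · have := (discr_ne_zero_iff_isCoprime h0 (hd.symm ▸ hn)).trans
      (isCoprime_iff_aeval_ne_zero_of_isAlgClosed L L _ _)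
    rw [← not_iff_not, ← ne_eq, this]
    push Not
    simp only [coe_aeval_eq_eval]
    grind

/-- For a quasi-homogeneous `f` the zeros of the discriminant are stable under scaling, as
`f(t ^ α * x, t ^ β * y) = t ^ w * f(x, y)`; so a nonzero root of it would make it
vanish identically. -/
theorem isNonzeroMonomial_discr_of_isQuasiHomogeneous {f : K[X][Y]}
    (hf : IsQuasiHomogeneousWithXWeight f) (hlc : IsNonzeroMonomial f.leadingCoeff)
    (hdisc : f.discr ≠ 0) : IsNonzeroMonomial f.discr := by
  let L := AlgebraicClosure K
  -- the weight of `x` may be taken positive, by changing all signs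
  obtain ⟨w, α, β, hα, hw⟩ : ∃ (w : ℤ) (α : ℕ) (β : ℤ), α ≠ 0 ∧
      ∀ i j : ℕ, (f.coeff j).coeff i ≠ 0 → w = α * (i : ℤ) + β * (j : ℤ) := by
    obtain ⟨w, α, β, hα, hw⟩ := hf
    rcases le_total 0 α with h | h
    · lift α to ℕ using h
      exact ⟨w, α, β, by exact_mod_cast hα, hw⟩
    · refine ⟨-w, α.natAbs, -β, Int.natAbs_ne_zero.2 hα, fun i j hij => ?_⟩
      rw [hw i j hij, Int.ofNat_natAbs_of_nonpos h]
      ring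
  rw [isNonzeroMonomial_iff L] at hlc ⊢
  intro a ha haz
  refine hdisc (Polynomial.map_injective (algebraMap K L) (algebraMap K L).injective ?_)
  rw [Polynomial.map_zero]
  refine eq_zero_of_infinite_isRoot _ (Set.Infinite.mono (s := {0}ᶜ) ?_
    (Set.finite_singleton (0 : L)).infinite_compl)
  intro a' ha'
  have ha' : a' ≠ 0 := ha'
  change eval a' _ = 0
  rw [eval_map_algebraMap]
  obtain ⟨t, ht⟩ := IsAlgClosed.exists_pow_nat_eq (a' / a) (Nat.pos_of_ne_zero hα)
  have ht0 : t ≠ 0 := by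
    rintro rfl
    rw [zero_pow hα] at ht
    exact div_ne_zero ha' ha ht.symm
  have hat : a' = a * t ^ α := by rw [ht, mul_div_cancel₀ _ ha]
  have hsp : specialize f a' = C (t ^ w) * (specialize f a).comp (C (t ^ (-β)) * X) := by
    ext j
    rw [coeff_C_mul, comp_C_mul_X_coeff, specialize_coeff, specialize_coeff, aeval_eq_sum_range,
      aeval_eq_sum_range, Finset.sum_mul, Finset.mul_sum]
    refine Finset.sum_congr rfl fun i _ => ?_
    by_cases hij : (f.coeff j).coeff i = 0
    · simp [hij]
    · have e : t ^ w * (t ^ (-β)) ^ j = (t ^ α) ^ i := by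
        rw [hw i j hij, ← zpow_natCast (t ^ (-β)), ← zpow_mul, ← zpow_add₀ ht0,
          ← pow_mul, ← zpow_natCast t]
        congr 1
        push_cast
        ring
      rw [hat, mul_pow, ← e, Algebra.smul_def, Algebra.smul_def]
      ring
  rw [aeval_discr_eq_zero_iff (hlc a ha)] at haz
  obtain ⟨y, hy, hy'⟩ := haz
  rw [aeval_discr_eq_zero_iff (hlc a' ha')]
  have hy2 : t ^ (-β) * (t ^ β * y) = y := by
    rw [← mul_assoc, ← zpow_add₀ ht0]; simp
  refine ⟨t ^ β * y, ?_, ?_⟩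
  · rw [hsp, eval_mul, eval_comp, eval_mul, eval_C, eval_C, eval_X, hy2, hy, mul_zero]
  · rw [hsp, derivative_C_mul, derivative_comp, eval_mul, eval_mul, eval_comp, eval_mul, eval_C,
      eval_C, eval_X, hy2, hy', mul_zero, mul_zero]

end

/-! ### Common points, and the equivalence -/

section

variable {K : Type*} [Field K]

/-- The multi-homogeneous polynomial `∑ u_ij x ^ i * x' ^ (m - i) * y ^ j * y' ^ (n - j)`. -/
noncomputable def multiForm (m n : ℕ) (u : ℕ → ℕ → K) : MvPolynomial (Fin 4) K :=
  ∑ i ∈ Finset.range (m + 1), ∑ j ∈ Finset.range (n + 1),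
    MvPolynomial.C (u i j) *
      MvPolynomial.X 0 ^ i * MvPolynomial.X 1 ^ (m - i) *
      MvPolynomial.X 2 ^ j * MvPolynomial.X 3 ^ (n - j)

theorem multiHomogenization_eq_multiForm (f : K[X][Y]) :
    multiHomogenization f = multiForm (degreeX f) f.natDegree fun i j => (f.coeff j).coeff i := rfl

/-- The operator `y * ∂/∂y` multiplies the coefficients by the exponents of `y`. -/
theorem X_mul_pderiv_multiForm (m n : ℕ) (u : ℕ → ℕ → K) :
    MvPolynomial.X 2 * MvPolynomial.pderiv 2 (multiForm m n u) =
      multiForm m n fun i j => j * u i j := by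
  rw [multiForm, multiForm, map_sum, Finset.mul_sum]
  refine Finset.sum_congr rfl fun i _ => ?_
  rw [map_sum, Finset.mul_sum]
  refine Finset.sum_congr rfl fun j _ => ?_
  rcases j with _ | j
  · simp [MvPolynomial.pderiv_X]
  · simp only [MvPolynomial.pderiv_mul, MvPolynomial.pderiv_pow, MvPolynomial.pderiv_X,
      MvPolynomial.pderiv_C, map_mul, map_natCast]
    simp
    ring

variable {L : Type*} [Field L] [Algebra K L]

theorem aeval_multiForm (m n : ℕ) (u : ℕ → ℕ → K) (a b : Fin 2 → L) :
    MvPolynomial.aeval ![a 0, a 1, b 0, b 1] (multiForm m n u) =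
      ∑ i ∈ Finset.range (m + 1), ∑ j ∈ Finset.range (n + 1),
        algebraMap K L (u i j) * a 0 ^ i * a 1 ^ (m - i) * b 0 ^ j * b 1 ^ (n - j) := by
  simp [multiForm, map_sum]

theorem aeval_multiForm_smul (m n : ℕ) (u : ℕ → ℕ → K) (s t : L) (a b : Fin 2 → L) :
    MvPolynomial.aeval ![(s • a) 0, (s • a) 1, (t • b) 0, (t • b) 1] (multiForm m n u) =
      s ^ m * t ^ n * MvPolynomial.aeval ![a 0, a 1, b 0, b 1] (multiForm m n u) := by
  rw [aeval_multiForm, aeval_multiForm, Finset.mul_sum]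
  refine Finset.sum_congr rfl fun i hi => ?_
  rw [Finset.mul_sum]
  refine Finset.sum_congr rfl fun j hj => ?_
  have hi' : s ^ m = s ^ i * s ^ (m - i) := by
    rw [← pow_add]; congr 1; have := Finset.mem_range.1 hi; omega
  have hj' : t ^ n = t ^ j * t ^ (n - j) := by
    rw [← pow_add]; congr 1; have := Finset.mem_range.1 hj; omega
  simp only [Pi.smul_apply, smul_eq_mul, mul_pow]
  rw [hi', hj']
  ring

/-- One choice of homogeneous coordinates suffices to test the vanishing of a `multiForm`. -/
theorem mk_mem_zeroLocus_multiForm (m n : ℕ) (u : ℕ → ℕ → K) {a b : Fin 2 → L} (ha : a ≠ 0)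
    (hb : b ≠ 0) :
    (Projectivization.mk L a ha, Projectivization.mk L b hb) ∈ zeroLocus L (multiForm m n u) ↔
      MvPolynomial.aeval ![a 0, a 1, b 0, b 1] (multiForm m n u) = 0 := by
  refine ⟨fun h => h a b ha hb rfl rfl, fun h a' b' ha' hb' haa hbb => ?_⟩
  obtain ⟨s, rfl⟩ := (Projectivization.mk_eq_mk_iff' L _ _ ha' ha).1 haa
  obtain ⟨t, rfl⟩ := (Projectivization.mk_eq_mk_iff' L _ _ hb' hb).1 hbb
  rw [aeval_multiForm_smul, h, mul_zero]

theorem natDegree_coeff_le_degreeX (f : K[X][Y]) (j : ℕ) :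
    (f.coeff j).natDegree ≤ degreeX f := by
  by_cases h : f.coeff j = 0
  · simp [h]
  · exact Finset.le_sup (f := fun j => (f.coeff j).natDegree) (mem_support_iff.2 h)

/-- For `v j = 1` this is the value of `f̂` at `([a : 1], b)`, for `v j = j` that of `y * f̂_y`. -/
theorem aeval_multiForm_coeff (f : K[X][Y]) (v : ℕ → K) (a : L) (b : Fin 2 → L) :
    MvPolynomial.aeval ![(![a, 1] : Fin 2 → L) 0, (![a, 1] : Fin 2 → L) 1, b 0, b 1]
        (multiForm (degreeX f) f.natDegree fun i j => v j * (f.coeff j).coeff i) =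
      ∑ j ∈ Finset.range (f.natDegree + 1),
        algebraMap K L (v j) * (specialize f a).coeff j * b 0 ^ j * b 1 ^ (f.natDegree - j) := by
  rw [aeval_multiForm, Finset.sum_comm]
  refine Finset.sum_congr rfl fun j _ => ?_
  rw [specialize_coeff, aeval_eq_sum_range' (Nat.lt_succ_of_le (natDegree_coeff_le_degreeX f j)),
    Finset.mul_sum, Finset.sum_mul, Finset.sum_mul]
  refine Finset.sum_congr rfl fun i _ => ?_
  simp only [Matrix.cons_val_zero, Matrix.cons_val_one, one_pow, Algebra.smul_def, map_mul]
  ring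

theorem sum_specialize_infinity (f : K[X][Y]) (v : ℕ → K) (a : L) :
    ∑ j ∈ Finset.range (f.natDegree + 1), algebraMap K L (v j) * (specialize f a).coeff j *
      (![1, 0] : Fin 2 → L) 0 ^ j * (![1, 0] : Fin 2 → L) 1 ^ (f.natDegree - j) =
      algebraMap K L (v f.natDegree) * aeval a f.leadingCoeff := by
  rw [Finset.sum_eq_single_of_mem f.natDegree (by simp)]
  · simp [specialize_coeff]
  · intro j hj hne
    have : f.natDegree - j ≠ 0 := by have := Finset.mem_range.1 hj; omega
    simp [this]

theorem sum_specialize (f : K[X][Y]) (a y : L) :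
    ∑ j ∈ Finset.range (f.natDegree + 1), algebraMap K L 1 * (specialize f a).coeff j *
      (![y, 1] : Fin 2 → L) 0 ^ j * (![y, 1] : Fin 2 → L) 1 ^ (f.natDegree - j) =
      (specialize f a).eval y := by
  rw [eval_eq_sum_range' (Nat.lt_succ_of_le (specialize_natDegree_le f a))]
  simp

theorem sum_specialize_derivative (f : K[X][Y]) (a y : L) :
    ∑ j ∈ Finset.range (f.natDegree + 1), algebraMap K L (j : K) * (specialize f a).coeff j *
      (![y, 1] : Fin 2 → L) 0 ^ j * (![y, 1] : Fin 2 → L) 1 ^ (f.natDegree - j) =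
      y * (derivative (specialize f a)).eval y := by
  have hd : (derivative (specialize f a)).natDegree < f.natDegree + 1 :=
    Nat.lt_succ_of_le ((natDegree_derivative_le _).trans
      ((Nat.sub_le _ _).trans (specialize_natDegree_le f a)))
  rw [eval_eq_sum_range' hd, Finset.sum_range_succ', Finset.sum_range_succ]
  have htop : (specialize f a).coeff (f.natDegree + 1) = 0 :=
    coeff_eq_zero_of_natDegree_lt (Nat.lt_succ_of_le (specialize_natDegree_le f a))
  rw [coeff_derivative, htop, zero_mul, zero_mul, add_zero, Finset.mul_sum]
  simp only [Nat.cast_zero, map_zero, zero_mul, add_zero]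
  refine Finset.sum_congr rfl fun j _ => ?_
  rw [coeff_derivative]
  simp only [Matrix.cons_val_zero, Matrix.cons_val_one, one_pow, map_natCast]
  push_cast
  ring

/-- The common points in `Lˣ × ℙ¹` lie over the roots of `f_0` (with `y = 0`), of the leading
coefficient (with `y = ∞`) and of the discriminant. -/
theorem noCommonPoint_iff (f : K[X][Y]) : NoCommonPoint f ↔ ∀ a : AlgebraicClosure K, a ≠ 0 →
    aeval a (f.coeff 0) ≠ 0 ∧ aeval a f.leadingCoeff ≠ 0 ∧ aeval a f.discr ≠ 0 := by
  set L := AlgebraicClosure K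
  have hy : MvPolynomial.X 2 * MvPolynomial.pderiv 2 (multiHomogenization f) =
      multiForm (degreeX f) f.natDegree fun i j => (j : K) * (f.coeff j).coeff i := by
    rw [multiHomogenization_eq_multiForm, X_mul_pderiv_multiForm]
  have h1 : multiHomogenization f =
      multiForm (degreeX f) f.natDegree fun i j => (1 : K) * (f.coeff j).coeff i := by
    simp only [one_mul]; rfl
  rw [NoCommonPoint, hy, h1, Set.eq_empty_iff_forall_notMem]
  constructor
  · intro h a ha
    have key : ∀ b : Fin 2 → L, b ≠ 0 → ¬
        (∑ j ∈ Finset.range (f.natDegree + 1), algebraMap K L 1 * (specialize f a).coeff j *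
            b 0 ^ j * b 1 ^ (f.natDegree - j) = 0 ∧
          ∑ j ∈ Finset.range (f.natDegree + 1), algebraMap K L (j : K) *
            (specialize f a).coeff j * b 0 ^ j * b 1 ^ (f.natDegree - j) = 0) := by
      rintro b hb ⟨e1, e2⟩
      refine h (Projectivization.mk L ![a, 1] (by simp), Projectivization.mk L b hb)
        ⟨⟨?_, ?_⟩, a, ha, rfl⟩
      · rw [mk_mem_zeroLocus_multiForm, aeval_multiForm_coeff f (fun _ => 1)]
        exact e1
      · rw [mk_mem_zeroLocus_multiForm, aeval_multiForm_coeff f (fun j => (j : K))]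
        exact e2
    have hlc : aeval a f.leadingCoeff ≠ 0 := by
      intro h0
      refine key ![1, 0] (by simp) ⟨?_, ?_⟩
      · rw [sum_specialize_infinity f (fun _ => 1), h0, mul_zero]
      · rw [sum_specialize_infinity f (fun j => (j : K)), h0, mul_zero]
    refine ⟨fun h0 => ?_, hlc, fun h0 => ?_⟩
    · refine key ![0, 1] (by simp) ⟨?_, ?_⟩
      · rw [sum_specialize, ← coeff_zero_eq_eval_zero, specialize_coeff, h0]
      · rw [sum_specialize_derivative, zero_mul]
    · obtain ⟨y, e1, e2⟩ := (aeval_discr_eq_zero_iff hlc).1 h0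
      refine key ![y, 1] (by simp) ⟨?_, ?_⟩
      · rw [sum_specialize, e1]
      · rw [sum_specialize_derivative, e2, mul_zero]
  · rintro h ⟨P, Q⟩ ⟨⟨hP1, hP2⟩, a, ha, hPa⟩
    obtain ⟨h0, hlc, hdisc⟩ := h a ha
    have hPa : P = Projectivization.mk L ![a, 1] (by simp) := hPa
    subst hPa
    have cases : Q = Projectivization.mk L ![1, 0] (by simp) ∨
        ∃ y : L, Q = Projectivization.mk L ![y, 1] (by simp) := by
      induction Q using Projectivization.ind with
      | h b hb =>
        by_cases hb1 : b 1 = 0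
        · left
          rw [Projectivization.mk_eq_mk_iff']
          refine ⟨b 0, ?_⟩
          ext i
          fin_cases i <;> simp [hb1]
        · right
          refine ⟨b 0 / b 1, ?_⟩
          rw [Projectivization.mk_eq_mk_iff']
          refine ⟨b 1, ?_⟩
          ext i
          fin_cases i <;> simp [hb1, mul_div_cancel₀]
    rcases cases with rfl | ⟨y, rfl⟩
    · rw [mk_mem_zeroLocus_multiForm, aeval_multiForm_coeff f (fun _ => 1),
        sum_specialize_infinity f (fun _ => 1), map_one, one_mul] at hP1
      exact hlc hP1
    · rw [mk_mem_zeroLocus_multiForm, aeval_multiForm_coeff f (fun _ => 1),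
        sum_specialize] at hP1
      rw [mk_mem_zeroLocus_multiForm, aeval_multiForm_coeff f (fun j => (j : K)),
        sum_specialize_derivative] at hP2
      rcases mul_eq_zero.1 hP2 with hy0 | hy0
      · rw [hy0, ← coeff_zero_eq_eval_zero, specialize_coeff] at hP1
        exact h0 hP1
      · exact hdisc ((aeval_discr_eq_zero_iff hlc).2 ⟨y, hP1, hy0⟩)

end

theorem IsNonzeroMonomial.map {K L : Type*} [Field K] [Field L] (i : K →+* L) {p : K[X]}
    (h : IsNonzeroMonomial p) : IsNonzeroMonomial (p.map i) := by
  obtain ⟨k, c, hc, rfl⟩ := h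
  exact ⟨k, i c, (_root_.map_ne_zero i).2 hc, map_monomial i⟩

/-- The equivalence, with the hypotheses on reducedness and on the characteristic in the form in
which the proof uses them. -/
theorem isQuasiHomogeneous_tfae {K : Type*} [Field K] {f : K[X][Y]} {d : ℕ}
    (hd : TotalDegreeLE f d)
    (hchar : ∀ z : ℤ, |z| ≤ 2 * d ^ 2 + d → (z : K) = 0 → z = 0)
    (h0 : f.coeff 0 ≠ 0) (hdisc : f.discr ≠ 0) :
    List.TFAE
      [IsQuasiHomogeneousWithXWeight f,
       IsNonzeroMonomial (f.coeff 0) ∧ IsNonzeroMonomial f.leadingCoeff ∧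
         IsNonzeroMonomial f.discr,
       NoCommonPoint f] := by
  have hlc0 : f.leadingCoeff ≠ 0 := by
    rw [leadingCoeff_ne_zero]; rintro rfl; simp at h0
  tfae_have 1 → 2 := by
    intro hA
    have hmon : ∀ j, f.coeff j ≠ 0 → IsNonzeroMonomial (f.coeff j) := by
      obtain ⟨w, α, β, hα, hw⟩ := hA
      refine fun j hj => isNonzeroMonomial_of_coeff hj fun i i' hi hi' => ?_
      have e := (hw i j hi).symm.trans (hw i' j hi')
      exact_mod_cast mul_left_cancel₀ hα (add_right_cancel e)
    exact ⟨hmon 0 h0, hmon _ hlc0,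
      isNonzeroMonomial_discr_of_isQuasiHomogeneous hA (hmon _ hlc0) hdisc⟩
  tfae_have 2 → 1 := by
    rintro ⟨m0, mlc, mdisc⟩
    let i : K →+* AlgebraicClosure K := algebraMap K (AlgebraicClosure K)
    have hi : Function.Injective (mapRingHom i) := map_injective i i.injective
    have hcoeff : ∀ a b : ℕ,
        ((f.map (mapRingHom i)).coeff b).coeff a = i ((f.coeff b).coeff a) := by
      intro a b
      rw [coeff_map, coe_mapRingHom, coeff_map]
    have hne : ∀ a b : ℕ,
        ((f.map (mapRingHom i)).coeff b).coeff a ≠ 0 ↔ (f.coeff b).coeff a ≠ 0 := by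
      intro a b
      rw [hcoeff, _root_.map_ne_zero]
    have hq := isQuasiHomogeneous_of_isNonzeroMonomial (f := f.map (mapRingHom i)) (d := d)
      (fun a b hab => hd a b ((hne a b).1 hab))
      (fun z hz hz0 => hchar z hz (by
        have : i (z : K) = 0 := by rw [map_intCast, hz0]
        exact (map_eq_zero i).1 this))
      (by rw [coeff_map]; exact m0.map i)
      (by rw [leadingCoeff_map_of_injective hi]; exact mlc.map i)
      (by
        rw [discr_map (mapRingHom i) f ((map_ne_zero_iff _ hi).2 hlc0)]
        exact mdisc.map i)
    obtain ⟨w, α, β, hα, hw⟩ := hq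
    exact ⟨w, α, β, hα, fun a b hab => hw a b ((hne a b).2 hab)⟩
  tfae_have 2 ↔ 3 := by
    rw [noCommonPoint_iff, isNonzeroMonomial_iff (AlgebraicClosure K),
      isNonzeroMonomial_iff (AlgebraicClosure K), isNonzeroMonomial_iff (AlgebraicClosure K)]
    exact ⟨fun h a ha => ⟨h.1 a ha, h.2.1 a ha, h.2.2 a ha⟩,
      fun h => ⟨fun a ha => (h a ha).1, fun a ha => (h a ha).2.1, fun a ha => (h a ha).2.2⟩⟩
  tfae_finish

end BivariateDisc

theorem theorem4p1 :
    (∀ (K : Type*) [Field K] [CharZero K] (f : K[X][Y]),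
      f.coeff 0 ≠ 0 → Squarefree f →
        List.TFAE
          [BivariateDisc.IsQuasiHomogeneousWithXWeight f,
           BivariateDisc.IsNonzeroMonomial (f.coeff 0) ∧
             BivariateDisc.IsNonzeroMonomial f.leadingCoeff ∧
             BivariateDisc.IsNonzeroMonomial f.discr,
           BivariateDisc.NoCommonPoint f]) ∧
    (∀ d : ℕ, ∃ N : ℕ, ∀ (K : Type*) [Field K] (p : ℕ) [CharP K p], N < p →
      ∀ f : K[X][Y],
        f.coeff 0 ≠ 0 → BivariateDisc.TotalDegreeLE f d →
        BivariateDisc.IsGeometricallyReduced f →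
        List.TFAE
          [BivariateDisc.IsQuasiHomogeneousWithXWeight f,
           BivariateDisc.IsNonzeroMonomial (f.coeff 0) ∧
             BivariateDisc.IsNonzeroMonomial f.leadingCoeff ∧
             BivariateDisc.IsNonzeroMonomial f.discr,
           BivariateDisc.NoCommonPoint f]) := by
  refine ⟨fun K _ _ f h0 hsq => ?_, fun d => ⟨2 * d ^ 2 + d, fun K _ p _ hp f h0 hd hred => ?_⟩⟩
  · have hd : BivariateDisc.TotalDegreeLE f (BivariateDisc.degreeX f + f.natDegree) := by
      intro i j hij
      refine add_le_add ?_ ?_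
      · exact (le_natDegree_of_ne_zero hij).trans (BivariateDisc.natDegree_coeff_le_degreeX f j)
      · refine le_natDegree_of_ne_zero fun h => hij ?_
        rw [h, coeff_zero]
    exact BivariateDisc.isQuasiHomogeneous_tfae hd (fun z _ hz => by exact_mod_cast hz) h0
      (BivariateDisc.discr_ne_zero_of_squarefree hsq
        fun k hk _ => by exact_mod_cast hk.ne')
  · have hchar : ∀ z : ℤ, |z| ≤ 2 * d ^ 2 + d → (z : K) = 0 → z = 0 := by
      intro z hz hz0
      refine Int.eq_zero_of_abs_lt_dvd ((CharP.intCast_eq_zero_iff K p z).1 hz0) (hz.trans_lt ?_)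
      exact_mod_cast hp
    have hf : f.leadingCoeff ≠ 0 := by
      rw [leadingCoeff_ne_zero]; rintro rfl; simp at h0
    let i : K →+* AlgebraicClosure K := algebraMap K (AlgebraicClosure K)
    have hi : Function.Injective (mapRingHom i) := map_injective i i.injective
    have hdisc : (f.map (mapRingHom i)).discr ≠ 0 := by
      refine BivariateDisc.discr_ne_zero_of_squarefree hred fun k hk hk' h => ?_
      rw [natDegree_map_eq_of_injective hi] at hk'
      have hkd := hk'.trans (BivariateDisc.natDegree_le_of_totalDegreeLE hd)
      have hk0 : i (k : K) = 0 := by rw [map_natCast, h]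
      have := hchar k (by rw [Nat.abs_cast]; norm_cast; nlinarith)
        (by rw [Int.cast_natCast]; exact (map_eq_zero i).1 hk0)
      omega
    refine BivariateDisc.isQuasiHomogeneous_tfae hd hchar h0 fun h => hdisc ?_
    rw [BivariateDisc.discr_map (mapRingHom i) f ((map_ne_zero_iff _ hi).2 hf), h, map_zero]
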